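/- **Setting.** Let $\mathcal X\subseteq\mathbb R$ and let $(X_i,Y_i)_{i=1}^n$, $n\ge 1$, be i.i.d. with $Y_i=f^0(X_i)+\epsilon_i$, $X_i\in\mathcal X$, $E\epsilon_1^2<\infty$. Let $\mathbf F$ be a real vector space of measurable functions $f:\mathcal X\to\mathbb R$ with $\|f\|^2:=E f(X_1)^2<\infty$. For $f\in\mathbf F$ let $\rho_f(x,y)=(y-f(x))^2$, $P_n\rho_f=\frac1n\sum_i\rho_f(X_i,Y_i)$, $P\rho_f=\frac1n\sum_iE\rho_f(X_i,Y_i)$; the target $f^0\in\mathbf F$ minimises $P\rho_f$ over $\mathbf F$, and $\Xi(f)=P(\rho_f-\rho_{f^0})$. For a fixed function $f$ write $E(f-f^0)^2=E(f(X_1)-f^0(X_1))^2$; for a random $\hat f$ this is evaluated at $f=\hat f$. Let $\psi_1,\dots,\psi_p\in\mathbf F$, $f_\beta=\sum_j\beta_j\psi_j$, $\Sigma=E(\psi(X_1)\psi(X_1)')$, let $\Phi\subseteq\mathbb R^p$ be convex, $\Gamma$ a collection of subsets of $\{1,\dots,p\}$, $\eta>0$ and $\mathbf F_{\rm local}=\{f\in\mathbf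 F:\sup_{x\in\mathcal X}|f(x)-f^0(x)|\le\eta\}$. For $\beta\in\mathbb R^p$ let $S_\beta=\{j:\beta_j\ne0\}$, $s_\beta=|S_\beta|$, and let $\beta_S$ be $\beta$ with the coordinates outside $S$ set to $0$. For $\lambda_1,\lambda_2>0$ let $L_\beta=3(\sqrt{s_\beta}+2\lambda_2\|\beta\|_2/\lambda_1)$ and, with $S=S_\beta$, $$\phi^2(S_\beta)=\min\Big\{\frac{\|f_b\|^2}{\|b_{S}\|_2^2}:\ b\in\mathbb R^p\setminus\{0\},\ \|b_{S^c}\|_1\le L_\beta\|b_{S}\|_2\Big\}.$$ Let $G(u)=u^2$ and $H(v)=\sup_{u\ge0}(uv-G(u))$. The oracle $\beta^*\neq 0$ minimises $$3\,\Xi(f_\beta)+2H\Big(\frac{4\lambda_1\sqrt{s_\beta}+4\lambda_2\|\beta\|_2}{\phi(S_\beta)}\Big)$$ over $\beta\in\Phi$ with $S_\beta\in\Gamma$, where $\lambda_2$ is either held fixed or is tuned to the candidate, $\lambda_2=\lambda_2(\beta)$; below, $\lambda_2$ denotes its value at $\beta^*$. Write $S^*=S_{\beta^*}$, $s^*=|S^*|$,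 $f^*=f_{\beta^*}$, $\phi_*=\phi(S^*)$ and $2\Delta^*$ for the minimal value. Let $\lambda_0>0$, $M^*=\Delta^*/\lambda_0$, $V_n(\beta)=\frac1n\sum_i[\rho_{f_\beta}(X_i,Y_i)-E\rho_{f_\beta}(X_i,Y_i)]$ and $$\tau=\Big\{\sup_{\|\beta-\beta^*\|_1\le M^*}|V_n(\beta)-V_n(\beta^*)|\le\lambda_0M^*\Big\}.$$ The elastic net $\hat\beta$ minimises $P_n\rho_{f_\beta}+\lambda_1\|\beta\|_1+\lambda_2\|\beta\|_2^2$ over $\beta\in\Phi$, and $\hat f=f_{\hat\beta}$. **Lemma.** Let $K>0$. There is a constant $d>0$, depending only on $K$, such that the following holds in every such setting. Assume $\max_j\sup_{x\in\mathcal X}|\psi_j(x)|\le K$, $\lambda_2=\frac{\lambda_1\sqrt{s^*}}{2\|\beta^*\|_2}$, $8\lambda_0\le\lambda_1\le L\lambda_0$ for some $L\ge8$, $\frac{36L^2\lambda_0s^*K}{\eta\phi_*^2}\le1$, $\sup_{x\in\mathcal X}|f^*(x)-f^0(x)|\le\eta/2$, $\frac32E(f^*-f^0)^2\le\frac{9\lambda_1^2s^*}{\phi_*^2}$,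 and that $\Sigma$ has full rank. Then: (a) $\Xi(f)\ge G(\|f-f^0\|)$ for all $f\in\mathbf F_{\rm local}$, where $G(u)=u^2$ is strictly convex on $[0,\infty)$ with $G(0)=0$ (Assumption 1); $f^*\in\mathbf F_{\rm local}$ and $f_\beta\in\mathbf F_{\rm local}$ for all $\beta$ with $\|\beta-\beta^*\|_1\le M^*$ (Assumption 2); $\phi_*>0$ (Assumption 3); and on $\tau$ $$E(\hat f-f^0)^2+\lambda_1\|\hat\beta-\beta^*\|_1+\lambda_2\|\hat\beta_{S^*}-\beta^*_{S^*}\|_2^2\le 6E(f^*-f^0)^2+\frac{36L^2\lambda_0^2s^*}{\phi_*^2}.\qquad(*)$$ (b) Assume in addition that $\frac1n\sum_{i=1}^n\max_jE\psi_j^2(X_i)\le1$, that for every $C>0$ one has $|f^0(x)|\le F_C<\infty$ for all $x\in\mathcal X$ with $|x|\le C$ (with $F_C\ge 0$), that $\Phi=\{\beta\in\mathbb R^p:\|\beta\|_1\le B\}$ with $B<\infty$, and that for some $\alpha,\delta>0$ and all $x\ge0$, $P(|X_1|\ge x)\le\alpha e^{-\delta x^2}$ and $P(|\epsilon_1|\ge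 x)\le\alpha e^{-\delta x^2}$. Then for every $C_n>0$, if $\lambda_0=dD_n\sqrt{\log(p)/n}$ with $D_n=2(C_n+2F_{C_n}+BK)$, inequality $(*)$ holds with probability at least $1-\frac1p-2\alpha n\exp(-\delta C_n^2)$. -/

import Mathlib

open MeasureTheory ProbabilityTheory

noncomputable section

namespace ElasticNet

/-! ### Vectors of coefficients -/

/-- The `ℓ₁`-norm of a coefficient vector. -/
def l1 {p : ℕ} (b : Fin p → ℝ) : ℝ := ∑ j, |b j|

/-- The `ℓ₂`-norm of a coefficient vector. -/
def l2 {p : ℕ} (b : Fin p → ℝ) : ℝ := √(∑ j, b j ^ 2)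

/-- `b_S`: the coordinates outside `S` are set to zero. -/
def restr {p : ℕ} (S : Finset (Fin p)) (b : Fin p → ℝ) : Fin p → ℝ :=
  fun j => if j ∈ S then b j else 0

/-- `S_b = {j : b_j ≠ 0}`. -/
def supp {p : ℕ} (b : Fin p → ℝ) : Finset (Fin p) :=
  Finset.univ.filter fun j => b j ≠ 0

/-! ### Convex conjugate -/

/-- The convex conjugate `H(v) = sup_{u ≥ 0} (u v - G(u))` of a margin function `G` on `[0, ∞)`. -/
def conjugate (G : ℝ → ℝ) (v : ℝ) : ℝ := sSup ((fun u => u * v - G u) '' Set.Ici 0)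

/-- The quadratic margin function `G(u) = u²`. -/
def sqMargin : ℝ → ℝ := fun u => u ^ 2

/-! ### The regression model -/

/-- The data of the regression problem with sample size `n` and `p` basis functions:
the covariate space `𝒳 ⊆ ℝ`, the covariates `X i`, the errors `ε i`, the function space `F`,
the target `f0`, the basis functions `ψ j`, the parameter set `Φ`, and the collection `Γ` of
index sets over which the oracle is defined. -/
structure Model (Ω : Type*) (n p : ℕ) where
  𝒳 : Set ℝ
  X : Fin n → Ω → 𝒳
  ε : Fin n → Ω → ℝ
  F : Submodule ℝ (𝒳 → ℝ)
  f0 : 𝒳 → ℝ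
  ψ : Fin p → 𝒳 → ℝ
  Φ : Set (Fin p → ℝ)
  Γ : Set (Finset (Fin p))

namespace Model

variable {Ω : Type*} {n p : ℕ} (M : Model Ω n p)

/-- The responses `Y_i = f⁰(X_i) + ε_i`. -/
def Y (i : Fin n) (ω : Ω) : ℝ := M.f0 (M.X i ω) + M.ε i ω

/-- The quadratic loss `ρ_f(x, y) = (y - f(x))²`. -/
def loss (f : M.𝒳 → ℝ) (x : M.𝒳) (y : ℝ) : ℝ := (y - f x) ^ 2

/-- `f_β = ∑_j β_j ψ_j`. -/
def fn (b : Fin p → ℝ) : M.𝒳 → ℝ := fun x => ∑ j, b j * M.ψ j x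

/-- The empirical risk `P_n ρ_f`. -/
def empRisk (f : M.𝒳 → ℝ) (ω : Ω) : ℝ :=
  (1 / (n : ℝ)) * ∑ i, M.loss f (M.X i ω) (M.Y i ω)

/-- `b` is a value of the elastic net estimator at the sample point `ω`: it minimises the
penalised empirical risk over `Φ`. -/
def IsElasticNet (lam1 lam2 : ℝ) (ω : Ω) (b : Fin p → ℝ) : Prop :=
  b ∈ M.Φ ∧ ∀ β ∈ M.Φ,
    M.empRisk (M.fn b) ω + lam1 * l1 b + lam2 * l2 b ^ 2
      ≤ M.empRisk (M.fn β) ω + lam1 * l1 β + lam2 * l2 β ^ 2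

/-- `F_local = {f ∈ F : ‖f - f⁰‖_∞ ≤ η}`. -/
def localSet (η : ℝ) : Set (M.𝒳 → ℝ) :=
  {f | f ∈ M.F ∧ ∀ x, |f x - M.f0 x| ≤ η}

variable [MeasurableSpace Ω] (μ : Measure Ω)

/-- The population risk `P ρ_f`. -/
def risk (f : M.𝒳 → ℝ) : ℝ :=
  (1 / (n : ℝ)) * ∑ i, ∫ ω, M.loss f (M.X i ω) (M.Y i ω) ∂μ

/-- The excess risk `Ξ(f) = P(ρ_f - ρ_{f⁰})`. -/
def excess (f : M.𝒳 → ℝ) : ℝ := M.risk μ f - M.risk μ M.f0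

/-- The centred empirical process `V_n(β)`. -/
def V (b : Fin p → ℝ) (ω : Ω) : ℝ :=
  (1 / (n : ℝ)) * ∑ i, (M.loss (M.fn b) (M.X i ω) (M.Y i ω)
    - ∫ ω', M.loss (M.fn b) (M.X i ω') (M.Y i ω') ∂μ)

/-- The local supremum `Z_r = sup_{‖β - β*‖₁ ≤ r} |V_n(β) - V_n(β*)|`. -/
def Z (βs : Fin p → ℝ) (r : ℝ) (ω : Ω) : ℝ :=
  sSup ((fun β => |M.V μ β ω - M.V μ βs ω|) '' {β | l1 (β - βs) ≤ r})

section iid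

variable [NeZero n]

/-- The `L₂(P)`-norm `(E f(X_1)²)^{1/2}`. -/
def norm2 (f : M.𝒳 → ℝ) : ℝ := √(∫ ω, f (M.X 0 ω) ^ 2 ∂μ)

/-- The mean square error `E(f - f⁰)² = E (f(X_1) - f⁰(X_1))²` of a fixed function `f`. -/
def mse (f : M.𝒳 → ℝ) : ℝ := ∫ ω, (f (M.X 0 ω) - M.f0 (M.X 0 ω)) ^ 2 ∂μ

/-- The population covariance matrix `Σ = E(ψ(X_1) ψ(X_1)')`. -/
def cov : Matrix (Fin p) (Fin p) ℝ :=
  Matrix.of fun j k => ∫ ω, M.ψ j (M.X 0 ω) * M.ψ k (M.X 0 ω) ∂μ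

/-- The standing assumptions on the model: `(X_i, Y_i)` is an i.i.d. sample with square
integrable errors, `F` is a vector space of measurable functions that are square integrable with
respect to the law of the covariates, the target `f⁰ ∈ F` minimises the population risk over `F`,
the basis functions belong to `F`, and `Φ` is convex. -/
structure Standing : Prop where
  measurable_X : ∀ i, Measurable (M.X i)
  measurable_ε : ∀ i, Measurable (M.ε i)
  indep : iIndepFun (fun i ω => (M.X i ω, M.Y i ω)) μ
  ident : ∀ i, IdentDistrib (fun ω => (M.X i ω, M.Y i ω)) (fun ω => (M.X 0 ω, M.Y 0 ω)) μ μ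
  memLp_ε : MemLp (M.ε 0) 2 μ
  measurable_F : ∀ f ∈ M.F, Measurable f
  memLp_F : ∀ f ∈ M.F, MemLp (fun ω => f (M.X 0 ω)) 2 μ
  f0_mem : M.f0 ∈ M.F
  f0_min : ∀ f ∈ M.F, M.risk μ M.f0 ≤ M.risk μ f
  ψ_mem : ∀ j, M.ψ j ∈ M.F
  convex_Φ : Convex ℝ M.Φ

/-- The margin condition with strictly convex margin function `G`, `G(0) = 0`. -/
def MarginCondition (η : ℝ) (G : ℝ → ℝ) : Prop :=
  StrictConvexOn ℝ (Set.Ici 0) G ∧ G 0 = 0 ∧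
    ∀ f ∈ M.localSet η, G (M.norm2 μ (f - M.f0)) ≤ M.excess μ f

/-- `L_n = 3 (√|S| + 2 λ₂ ‖β_S‖₂ / λ₁)`. -/
def Ln (lam1 lam2 : ℝ) (S : Finset (Fin p)) (β : Fin p → ℝ) : ℝ :=
  3 * (√(S.card : ℝ) + 2 * lam2 * l2 (restr S β) / lam1)

/-- The squared adaptive restricted eigenvalue `φ²(S)`, where the size `L_n` of the restricted
set is determined by the coefficient vector `β` under consideration (for `φ_*` this is `β*`) and
the minimum is taken over all `b ≠ 0` with `‖b_{Sᶜ}‖₁ ≤ L_n ‖b_S‖₂`. -/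
def phiSq (lam1 lam2 : ℝ) (S : Finset (Fin p)) (β : Fin p → ℝ) : ℝ :=
  sInf ((fun b => M.norm2 μ (M.fn b) ^ 2 / l2 (restr S b) ^ 2) ''
    {b | b ≠ 0 ∧ l1 (restr Sᶜ b) ≤ Ln lam1 lam2 S β * l2 (restr S b)})

/-- The adaptive restricted eigenvalue `φ(S_β)` belonging to the coefficient vector `β`. -/
def phi (lam1 lam2 : ℝ) (β : Fin p → ℝ) : ℝ := √(M.phiSq μ lam1 lam2 (supp β) β)

/-- The argument `(4 λ₁ √s_β + 4 λ₂ ‖β‖₂) / φ(S_β)` of the estimation error term. For `β = 0` it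
is `0`; for `β ≠ 0` the denominator is positive whenever `Σ` has full rank. -/
def estArg (lam1 lam2 : ℝ) (β : Fin p → ℝ) : ℝ :=
  (4 * lam1 * √((supp β).card : ℝ) + 4 * lam2 * l2 β) / M.phi μ lam1 lam2 β

/-- `Δ_β = (3 Ξ(f_β) + 2 H((4 λ₁ √s_β + 4 λ₂ ‖β‖₂) / φ(S_β))) / 2`, where `H` is the convex
conjugate of `G`. Twice this quantity is the objective of the oracle, and `Δ* = Δ_{β*}`. -/
def delta (G : ℝ → ℝ) (lam1 lam2 : ℝ) (β : Fin p → ℝ) : ℝ :=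
  (3 * M.excess μ (M.fn β) + 2 * conjugate G (M.estArg μ lam1 lam2 β)) / 2

/-- `βs` is an oracle: it minimises `2 Δ_β` over the `β ∈ Φ` with `S_β ∈ Γ`. The level `lam2 β` of
the ridge penalty is allowed to be tuned to the candidate `β`; a level which is held fixed is the
case of a constant function `lam2`. -/
def IsOracle (G : ℝ → ℝ) (lam1 : ℝ) (lam2 : (Fin p → ℝ) → ℝ) (βs : Fin p → ℝ) : Prop :=
  βs ∈ M.Φ ∧ supp βs ∈ M.Γ ∧ ∀ β ∈ M.Φ, supp β ∈ M.Γ →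
    2 * M.delta μ G lam1 (lam2 βs) βs ≤ 2 * M.delta μ G lam1 (lam2 β) β

/-- `M* = Δ* / λ₀`. -/
def Mstar (G : ℝ → ℝ) (lam0 lam1 lam2 : ℝ) (βs : Fin p → ℝ) : ℝ :=
  M.delta μ G lam1 lam2 βs / lam0

/-- The event `τ = {Z_{M*} ≤ λ₀ M*}`. -/
def tau (G : ℝ → ℝ) (lam0 lam1 lam2 : ℝ) (βs : Fin p → ℝ) : Set Ω :=
  {ω | M.Z μ βs (M.Mstar μ G lam0 lam1 lam2 βs) ω
    ≤ lam0 * M.Mstar μ G lam0 lam1 lam2 βs}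

/-- The oracle inequality
`E(f_b - f⁰)² + λ₁ ‖b - β*‖₁ + λ₂ ‖b_{S*} - β*_{S*}‖₂² ≤ 6 E(f* - f⁰)² + 36 L² λ₀² s* / φ_*²`
for a coefficient vector `b`. -/
def OracleInequality (L lam0 lam1 lam2 : ℝ) (βs b : Fin p → ℝ) : Prop :=
  M.mse μ (M.fn b) + lam1 * l1 (b - βs)
      + lam2 * l2 (restr (supp βs) b - restr (supp βs) βs) ^ 2
    ≤ 6 * M.mse μ (M.fn βs)
      + 36 * L ^ 2 * lam0 ^ 2 * ((supp βs).card : ℝ) / M.phi μ lam1 lam2 βs ^ 2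

end iid

end Model

/-- `V` is sub-gaussian with constants `α, δ > 0`: `P(|V| ≥ x) ≤ α exp(-δ x²)` for all `x ≥ 0`. -/
def SubGaussianTail {Ω : Type*} [MeasurableSpace Ω] (μ : Measure Ω) (V : Ω → ℝ) (α δ : ℝ) : Prop :=
  0 < α ∧ 0 < δ ∧ ∀ x : ℝ, 0 ≤ x → μ.real {ω | x ≤ |V ω|} ≤ α * Real.exp (-δ * x ^ 2)

end ElasticNet

end

open MeasureTheory ProbabilityTheory

namespace ElasticNet

/-! ### Norms of coefficient vectors -/

section vectors

variable {p : ℕ}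

/-! Since `f0` minimises the quadratic risk over a vector space, the errors are orthogonal to `F`,
so the excess risk is exactly the mean square error and the margin condition holds with equality
(`Standing.excess_eq`). The tuning of `lam2` gives `2 * lam2 * l2 βs = lam1 * √s`, so the ridge part
costs no more than the lasso part. Writing `v` for the distance of `f*` to `f0` and `a = 3 * lam1 *
√s / φ`, this yields `Δ* = 3/2 * v² + a²` (`Standing.delta_eq`).

Suppose that the empirical process moves by at most `Δ*` on the ball of radius `M*` around `βs`.
Comparing the penalised risks at `β` and `βs` leaves an error term on the support. Inside the
restricted cone the eigenvalue `φ` absorbs it into the distances to `f0`; outside, the off-support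
part of the penalty does (`cone_dichotomy`, `Standing.deviation_bounds`). The estimator need not lie
in the ball a priori, so the comparison is first made for a point of the segment from `βs` to the
estimator; convexity then brings the estimator itself into the ball
(`Standing.oracleInequality_of_deviation`). Part (a) follows, with `φ > 0` coming from the full rank
of `Σ`.

For part (b) the quadratic loss splits the increment of the process into a part linear in `Y` and a
part quadratic in the basis functions (`Standing.V_sub_eq`). By ℓ₁-duality only `p + p²` averages
have to be controlled, by Hoeffding and a union bound after truncating `Y`. The truncation bias
(`Standing.abs_integral_tail_le`) contains a term in `v`, which is absorbed into half of `Δ*`; the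
remaining terms take the other half (`Standing.abs_V_sub_le`,
`Standing.measureReal_oracleInequality_ge`). -/

lemma l1_nonneg (b : Fin p → ℝ) : 0 ≤ l1 b := Finset.sum_nonneg fun _ _ => abs_nonneg _

lemma l2_nonneg (b : Fin p → ℝ) : 0 ≤ l2 b := Real.sqrt_nonneg _

lemma l2_sq (b : Fin p → ℝ) : l2 b ^ 2 = ∑ j, b j ^ 2 :=
  Real.sq_sqrt (Finset.sum_nonneg fun _ _ => sq_nonneg _)

lemma l1_eq_zero {b : Fin p → ℝ} (h : l1 b = 0) : b = 0 := by
  funext j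
  have := (Finset.sum_eq_zero_iff_of_nonneg (fun j _ => abs_nonneg (b j))).1 h j (Finset.mem_univ j)
  simpa using this

lemma l2_eq_zero {b : Fin p → ℝ} (h : l2 b = 0) : b = 0 := by
  funext j
  have h2 : ∑ j, b j ^ 2 = 0 := by rw [← l2_sq, h]; norm_num
  have := (Finset.sum_eq_zero_iff_of_nonneg (fun j _ => sq_nonneg (b j))).1 h2 j (Finset.mem_univ j)
  simpa using this

lemma l1_add_le (b c : Fin p → ℝ) : l1 (b + c) ≤ l1 b + l1 c := by
  unfold l1
  rw [← Finset.sum_add_distrib]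
  exact Finset.sum_le_sum fun j _ => abs_add_le _ _

lemma l1_sub_le (b c : Fin p → ℝ) : l1 (b - c) ≤ l1 b + l1 c := by
  unfold l1
  rw [← Finset.sum_add_distrib]
  exact Finset.sum_le_sum fun j _ => abs_sub _ _

lemma l1_smul (t : ℝ) (b : Fin p → ℝ) : l1 (t • b) = |t| * l1 b := by
  simp [l1, abs_mul, Finset.mul_sum]

lemma l1_eq_restr_add (S : Finset (Fin p)) (b : Fin p → ℝ) :
    l1 b = l1 (restr S b) + l1 (restr Sᶜ b) := by
  unfold l1 restr
  rw [← Finset.sum_add_distrib]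
  refine Finset.sum_congr rfl fun j _ => ?_
  by_cases h : j ∈ S <;> simp [h]

lemma restr_sub (S : Finset (Fin p)) (b c : Fin p → ℝ) :
    restr S (b - c) = restr S b - restr S c := by
  funext j
  by_cases h : j ∈ S <;> simp [restr, h]

lemma restr_supp (b : Fin p → ℝ) : restr (supp b) b = b := by
  funext j
  by_cases h : b j = 0 <;> simp [restr, supp, h]

lemma supp_nonempty {b : Fin p → ℝ} (h : b ≠ 0) : (supp b).Nonempty := by
  obtain ⟨j, hj⟩ := Function.ne_iff.1 h
  exact ⟨j, by simpa [supp] using hj⟩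

lemma l2_pos {b : Fin p → ℝ} (h : b ≠ 0) : 0 < l2 b :=
  (l2_nonneg b).lt_of_ne fun h0 => h (l2_eq_zero h0.symm)

lemma l2_restr_le (S : Finset (Fin p)) (b : Fin p → ℝ) : l2 (restr S b) ≤ l2 b := by
  refine Real.sqrt_le_sqrt (Finset.sum_le_sum fun j _ => ?_)
  by_cases h : j ∈ S <;> simp [restr, h, sq_nonneg]

lemma l1_restr_le (S : Finset (Fin p)) (b : Fin p → ℝ) :
    l1 (restr S b) ≤ √(S.card : ℝ) * l2 (restr S b) := by
  rw [l2, ← Real.sqrt_mul (Nat.cast_nonneg _)]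
  refine Real.le_sqrt_of_sq_le ?_
  have h1 : l1 (restr S b) = ∑ j ∈ S, |b j| := by
    simp [l1, restr, apply_ite abs, Finset.sum_ite_mem]
  have h2 : ∑ j, restr S b j ^ 2 = ∑ j ∈ S, |b j| ^ 2 := by
    simp [restr, Finset.sum_ite_mem, ite_pow]
  rw [h1, h2]
  exact sq_sum_le_card_mul_sum_sq

lemma sum_mul_le_l2_mul_l2 (b c : Fin p → ℝ) : ∑ j, b j * c j ≤ l2 b * l2 c :=
  Real.sum_mul_le_sqrt_mul_sqrt _ _ _

/-- The elastic net penalty at `β*` exceeds the penalty at `b` by at most a term in the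
deviation on the support of `β*`, minus the deviation off the support. -/
lemma penalty_sub_le {lam1 lam2 : ℝ} (h1 : 0 ≤ lam1) (h2 : 0 ≤ lam2) (βs b : Fin p → ℝ) :
    lam1 * l1 βs + lam2 * l2 βs ^ 2 - (lam1 * l1 b + lam2 * l2 b ^ 2)
      ≤ lam1 * l1 (restr (supp βs) (b - βs)) - lam1 * l1 (restr (supp βs)ᶜ (b - βs))
        + 2 * lam2 * (l2 βs * l2 (restr (supp βs) (b - βs)))
        - lam2 * l2 (restr (supp βs) (b - βs)) ^ 2 := by
  set S := supp βs with hS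
  have e1 : l1 βs - l1 b ≤ l1 (restr S (b - βs)) - l1 (restr Sᶜ (b - βs)) := by
    unfold l1
    rw [← Finset.sum_sub_distrib, ← Finset.sum_sub_distrib]
    refine Finset.sum_le_sum fun j _ => ?_
    by_cases h : βs j = 0
    · simp [restr, hS, supp, h]
    · simp only [restr, hS, supp, Finset.mem_filter, Finset.mem_univ, true_and, ne_eq, h,
        not_false_eq_true, if_true, Finset.mem_compl, not_true_eq_false, if_false, abs_zero,
        Pi.sub_apply, sub_zero]
      have := abs_sub_abs_le_abs_sub (βs j) (b j)
      rwa [abs_sub_comm (βs j) (b j)] at this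
  -- On the support this is `β² - b² = -2β(b - β) - (b - β)²` followed by Cauchy–Schwarz; off the
  -- support `-b²` is dropped.
  have e2 : l2 βs ^ 2 - l2 b ^ 2
      ≤ 2 * (l2 βs * l2 (restr S (b - βs))) - l2 (restr S (b - βs)) ^ 2 := by
    have hin := sum_mul_le_l2_mul_l2 (fun j => -βs j) (restr S (b - βs))
    have hn : l2 (fun j => -βs j) = l2 βs := by simp [l2]
    rw [hn] at hin
    have : l2 βs ^ 2 - l2 b ^ 2 ≤ 2 * ∑ j, -βs j * restr S (b - βs) j
        - l2 (restr S (b - βs)) ^ 2 := by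
      rw [l2_sq, l2_sq, l2_sq, Finset.mul_sum, ← Finset.sum_sub_distrib, ← Finset.sum_sub_distrib]
      refine Finset.sum_le_sum fun j _ => ?_
      by_cases h : βs j = 0
      · simp [restr, hS, supp, h, sq_nonneg]
      · simp only [restr, hS, supp, Finset.mem_filter, Finset.mem_univ, true_and, ne_eq, h,
          not_false_eq_true, if_true, Pi.sub_apply]
        nlinarith
    linarith
  nlinarith [mul_le_mul_of_nonneg_left e1 h1, mul_le_mul_of_nonneg_left e2 h2]

lemma l1_convex {t : ℝ} (h0 : 0 ≤ t) (h1 : t ≤ 1) (b c : Fin p → ℝ) :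
    l1 (t • b + (1 - t) • c) ≤ t * l1 b + (1 - t) * l1 c := by
  have := l1_add_le (t • b) ((1 - t) • c)
  rwa [l1_smul, l1_smul, abs_of_nonneg h0, abs_of_nonneg (sub_nonneg.2 h1)] at this

lemma sq_convex {t : ℝ} (h0 : 0 ≤ t) (h1 : t ≤ 1) (x y : ℝ) :
    (t * x + (1 - t) * y) ^ 2 ≤ t * x ^ 2 + (1 - t) * y ^ 2 := by
  nlinarith [mul_nonneg (mul_nonneg h0 (sub_nonneg.2 h1)) (sq_nonneg (x - y))]

lemma l2_sq_convex {t : ℝ} (h0 : 0 ≤ t) (h1 : t ≤ 1) (b c : Fin p → ℝ) :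
    l2 (t • b + (1 - t) • c) ^ 2 ≤ t * l2 b ^ 2 + (1 - t) * l2 c ^ 2 := by
  rw [l2_sq, l2_sq, l2_sq, Finset.mul_sum, Finset.mul_sum, ← Finset.sum_add_distrib]
  exact Finset.sum_le_sum fun j _ => by simpa using sq_convex h0 h1 (b j) (c j)

end vectors

/-! ### Scalar facts -/

lemma conjugate_sqMargin {v : ℝ} (hv : 0 ≤ v) : conjugate sqMargin v = v ^ 2 / 4 := by
  have : IsGreatest ((fun u => u * v - sqMargin u) '' Set.Ici 0) (v ^ 2 / 4) := by
    refine ⟨⟨v / 2, Set.mem_Ici.2 (by linarith), by simp [sqMargin]; ring⟩, ?_⟩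
    rintro _ ⟨u, -, rfl⟩
    simp only [sqMargin]
    nlinarith [sq_nonneg (u - v / 2)]
  exact this.csSup_eq

/-- The case distinction between deviations inside and outside of the restricted cone. -/
lemma cone_dichotomy {u v a lam1 lam2 x y z r D : ℝ} (hl1 : 0 < lam1) (hl2 : 0 ≤ lam2)
    (hy : 0 ≤ y) (hx : x ≤ r * z) (hrz : 0 ≤ r * z)
    (hD : D = 3 / 2 * v ^ 2 + a ^ 2)
    (h : u ^ 2 + lam1 * y + lam2 * z ^ 2 ≤ D + v ^ 2 + 2 * (lam1 * (r * z)))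
    (hc : y ≤ 6 * (r * z) → 3 * (lam1 * (r * z)) ≤ a * (u + v)) :
    u ^ 2 + lam1 * (x + y) + lam2 * z ^ 2 ≤ 4 * D ∧ lam1 * (x + y) ≤ 3 * D := by
  have hx' : lam1 * x ≤ lam1 * (r * z) := mul_le_mul_of_nonneg_left hx hl1.le
  have hz : 0 ≤ lam2 * z ^ 2 := by positivity
  have hrz' : 0 ≤ lam1 * (r * z) := by positivity
  have hy' : 0 ≤ lam1 * y := by positivity
  have hv2 := sq_nonneg v
  have hu2 := sq_nonneg u
  have ha2 := sq_nonneg a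
  -- In the cone, `a * u ≤ (a² + u²) / 2` and `a * v ≤ (a² + v²) / 2` bound the error term; half of
  -- `u²` moves to the left.
  by_cases hcone : y ≤ 6 * (r * z)
  · have h3 := hc hcone
    have s1 := sq_nonneg (a - u)
    have s2 := sq_nonneg (a - v)
    constructor
    · by_cases hxy : 0 ≤ lam1 * (x + y)
      · nlinarith
      · nlinarith
    · nlinarith
  -- Off the cone `2 * lam1 * r * z ≤ lam1 * y / 3`, so `lam1 * y ≤ 3/2 * (D + v²) ≤ 5/2 * D`. As `x
  -- ≤ y / 6`, the ℓ₁ term is at most `35/12 * D`, which is where the factor 3 is nearly attained.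
  · have h4 : lam1 * (6 * (r * z)) ≤ lam1 * y := mul_le_mul_of_nonneg_left (not_le.1 hcone).le hl1.le
    constructor <;> nlinarith

/-! ### Square integrable functions -/

section L2

variable {Ω : Type*} [MeasurableSpace Ω] {μ : Measure Ω}

lemma integral_lincomb {f g h : Ω → ℝ} (hf : Integrable f μ) (hg : Integrable g μ)
    (hh : Integrable h μ) (x y z : ℝ) :
    ∫ ω, (x * f ω + y * g ω + z * h ω) ∂μ
      = x * ∫ ω, f ω ∂μ + y * ∫ ω, g ω ∂μ + z * ∫ ω, h ω ∂μ := by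
  have h1 : Integrable (fun ω => x * f ω + y * g ω) μ := (hf.const_mul x).add (hg.const_mul y)
  rw [integral_add h1 (hh.const_mul z), integral_add (hf.const_mul x) (hg.const_mul y),
    integral_const_mul, integral_const_mul, integral_const_mul]

lemma sq_integral_mul_le {f g : Ω → ℝ} (hf : MemLp f 2 μ) (hg : MemLp g 2 μ) :
    (∫ ω, f ω * g ω ∂μ) ^ 2 ≤ (∫ ω, f ω ^ 2 ∂μ) * ∫ ω, g ω ^ 2 ∂μ := by
  have hff := hf.integrable_sq
  have hgg := hg.integrable_sq
  have hfg : Integrable (fun ω => f ω * g ω) μ := hf.integrable_mul hg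
  -- The quadratic polynomial `t ↦ ∫ (t g + f)²` is nonnegative, so its discriminant is not
  -- positive.
  have key : ∀ t : ℝ, 0 ≤ (∫ ω, g ω ^ 2 ∂μ) * (t * t) + (2 * ∫ ω, f ω * g ω ∂μ) * t
      + ∫ ω, f ω ^ 2 ∂μ := by
    intro t
    have h0 : 0 ≤ ∫ ω, (t * t * g ω ^ 2 + 2 * t * (f ω * g ω) + 1 * f ω ^ 2) ∂μ :=
      integral_nonneg fun ω => by
        have : t * t * g ω ^ 2 + 2 * t * (f ω * g ω) + 1 * f ω ^ 2 = (t * g ω + f ω) ^ 2 := by ring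
        simp only [Pi.zero_apply, this]
        positivity
    rw [integral_lincomb hgg hfg hff] at h0
    linarith
  have := discrim_le_zero key
  unfold discrim at this
  nlinarith

lemma abs_integral_mul_le {f g : Ω → ℝ} (hf : MemLp f 2 μ) (hg : MemLp g 2 μ) :
    |∫ ω, f ω * g ω ∂μ| ≤ √(∫ ω, f ω ^ 2 ∂μ) * √(∫ ω, g ω ^ 2 ∂μ) := by
  rw [← Real.sqrt_mul (integral_nonneg fun _ => sq_nonneg _)]
  exact Real.abs_le_sqrt (sq_integral_mul_le hf hg)

lemma sqrt_integral_sub_sq_le {f g : Ω → ℝ} (hf : MemLp f 2 μ) (hg : MemLp g 2 μ) :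
    √(∫ ω, (f ω - g ω) ^ 2 ∂μ) ≤ √(∫ ω, f ω ^ 2 ∂μ) + √(∫ ω, g ω ^ 2 ∂μ) := by
  refine Real.sqrt_le_iff.2 ⟨by positivity, ?_⟩
  have hff := hf.integrable_sq
  have hgg := hg.integrable_sq
  have hfg : Integrable (fun ω => f ω * g ω) μ := hf.integrable_mul hg
  have e : ∫ ω, (f ω - g ω) ^ 2 ∂μ
      = 1 * ∫ ω, f ω ^ 2 ∂μ + (-2) * ∫ ω, f ω * g ω ∂μ + 1 * ∫ ω, g ω ^ 2 ∂μ := by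
    rw [← integral_lincomb hff hfg hgg]
    exact integral_congr_ae (.of_forall fun ω => by simp only; ring)
  have h1 := neg_le_of_abs_le (abs_integral_mul_le hf hg)
  have h2 := Real.sq_sqrt (integral_nonneg (μ := μ) fun ω => sq_nonneg (f ω))
  have h3 := Real.sq_sqrt (integral_nonneg (μ := μ) fun ω => sq_nonneg (g ω))
  rw [e]
  nlinarith

end L2

namespace Model

/-! ### Consequences of the standing assumptions -/

section linear

variable {Ω : Type*} {n p : ℕ} (M : Model Ω n p)

lemma fn_sub (b c : Fin p → ℝ) (x : M.𝒳) : M.fn b x - M.fn c x = M.fn (b - c) x := by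
  simp [fn, sub_mul]

lemma fn_add (b c : Fin p → ℝ) (x : M.𝒳) : M.fn b x + M.fn c x = M.fn (b + c) x := by
  simp [fn, add_mul, Finset.sum_add_distrib]

lemma fn_combo (t s : ℝ) (b c : Fin p → ℝ) (x : M.𝒳) :
    M.fn (t • b + s • c) x = t * M.fn b x + s * M.fn c x := by
  simp only [fn, Finset.mul_sum, ← Finset.sum_add_distrib]
  exact Finset.sum_congr rfl fun j _ => by simp; ring

variable {M} in
lemma abs_fn_le {K : ℝ} (hK : ∀ j x, |M.ψ j x| ≤ K) (b : Fin p → ℝ) (x : M.𝒳) :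
    |M.fn b x| ≤ l1 b * K := by
  unfold fn l1
  rw [Finset.sum_mul]
  refine (Finset.abs_sum_le_sum_abs _ _).trans (Finset.sum_le_sum fun j _ => ?_)
  rw [abs_mul]
  exact mul_le_mul_of_nonneg_left (hK j x) (abs_nonneg _)

lemma empRisk_convex {t : ℝ} (h0 : 0 ≤ t) (h1 : t ≤ 1) (b c : Fin p → ℝ) (ω : Ω) :
    M.empRisk (M.fn (t • b + (1 - t) • c)) ω
      ≤ t * M.empRisk (M.fn b) ω + (1 - t) * M.empRisk (M.fn c) ω := by
  unfold empRisk
  have : ∑ i, M.loss (M.fn (t • b + (1 - t) • c)) (M.X i ω) (M.Y i ω)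
      ≤ t * ∑ i, M.loss (M.fn b) (M.X i ω) (M.Y i ω)
        + (1 - t) * ∑ i, M.loss (M.fn c) (M.X i ω) (M.Y i ω) := by
    rw [Finset.mul_sum, Finset.mul_sum, ← Finset.sum_add_distrib]
    refine Finset.sum_le_sum fun i _ => ?_
    unfold loss
    rw [fn_combo]
    have e : M.Y i ω - (t * M.fn b (M.X i ω) + (1 - t) * M.fn c (M.X i ω))
        = t * (M.Y i ω - M.fn b (M.X i ω)) + (1 - t) * (M.Y i ω - M.fn c (M.X i ω)) := by ring
    rw [e]
    exact sq_convex h0 h1 _ _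
  have hn : (0 : ℝ) ≤ 1 / n := by positivity
  nlinarith [mul_le_mul_of_nonneg_left this hn]

lemma V_eq [MeasurableSpace Ω] (μ : Measure Ω) (b : Fin p → ℝ) (ω : Ω) :
    M.V μ b ω = M.empRisk (M.fn b) ω - M.risk μ (M.fn b) := by
  unfold V empRisk risk
  rw [Finset.sum_sub_distrib, mul_sub]

end linear

section standing

variable {Ω : Type*} [MeasurableSpace Ω] {μ : Measure Ω} {n p : ℕ} [NeZero n] {M : Model Ω n p}

lemma norm2_nonneg (f : M.𝒳 → ℝ) : 0 ≤ M.norm2 μ f := Real.sqrt_nonneg _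

lemma norm2_sq (f : M.𝒳 → ℝ) : M.norm2 μ f ^ 2 = ∫ ω, f (M.X 0 ω) ^ 2 ∂μ :=
  Real.sq_sqrt (integral_nonneg fun _ => sq_nonneg _)

lemma mse_eq (f : M.𝒳 → ℝ) : M.mse μ f = M.norm2 μ (f - M.f0) ^ 2 := by
  rw [norm2_sq]; rfl

variable (h : M.Standing μ)
include h

lemma Standing.fn_mem (b : Fin p → ℝ) : M.fn b ∈ M.F := by
  have : M.fn b = ∑ j, b j • M.ψ j := by
    funext x
    simp [fn]
  rw [this]
  exact M.F.sum_mem fun j _ => M.F.smul_mem _ (h.ψ_mem j)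

lemma Standing.measurable_Y (i : Fin n) : Measurable (M.Y i) :=
  ((h.measurable_F _ h.f0_mem).comp (h.measurable_X i)).add (h.measurable_ε i)

lemma Standing.integral_pair {g : M.𝒳 × ℝ → ℝ} (hg : Measurable g) (i : Fin n) :
    ∫ ω, g (M.X i ω, M.Y i ω) ∂μ = ∫ ω, g (M.X 0 ω, M.Y 0 ω) ∂μ :=
  ((h.ident i).comp hg).integral_eq

lemma Standing.measurable_loss {f : M.𝒳 → ℝ} (hf : f ∈ M.F) :
    Measurable fun z : M.𝒳 × ℝ => M.loss f z.1 z.2 := by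
  have := h.measurable_F f hf
  unfold loss
  fun_prop

lemma Standing.risk_eq {f : M.𝒳 → ℝ} (hf : f ∈ M.F) :
    M.risk μ f = ∫ ω, (M.Y 0 ω - f (M.X 0 ω)) ^ 2 ∂μ := by
  unfold risk
  have : ∀ i : Fin n, ∫ ω, M.loss f (M.X i ω) (M.Y i ω) ∂μ
      = ∫ ω, (M.Y 0 ω - f (M.X 0 ω)) ^ 2 ∂μ := fun i => h.integral_pair (h.measurable_loss hf) i
  have hn : (n : ℝ) ≠ 0 := Nat.cast_ne_zero.2 (NeZero.ne n)
  simp only [this, Finset.sum_const, Finset.card_univ, Fintype.card_fin, nsmul_eq_mul]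
  field_simp

lemma Standing.memLp_Y : MemLp (M.Y 0) 2 μ := (h.memLp_F _ h.f0_mem).add h.memLp_ε

lemma Standing.risk_add_smul {g : M.𝒳 → ℝ} (hg : g ∈ M.F) (t : ℝ) :
    M.risk μ (M.f0 + t • g) = M.risk μ M.f0 + (-2 * t) * ∫ ω, M.ε 0 ω * g (M.X 0 ω) ∂μ
      + t ^ 2 * ∫ ω, g (M.X 0 ω) ^ 2 ∂μ := by
  rw [h.risk_eq (M.F.add_mem h.f0_mem (M.F.smul_mem t hg)), h.risk_eq h.f0_mem]
  have e1 : (fun ω => (M.Y 0 ω - M.f0 (M.X 0 ω)) ^ 2) = fun ω => M.ε 0 ω ^ 2 := by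
    funext ω; simp [Y]
  have e2 : (fun ω => (M.Y 0 ω - (M.f0 + t • g) (M.X 0 ω)) ^ 2)
      = fun ω => 1 * M.ε 0 ω ^ 2 + (-2 * t) * (M.ε 0 ω * g (M.X 0 ω))
        + t ^ 2 * g (M.X 0 ω) ^ 2 := by
    funext ω; simp [Y]; ring
  have hgL := h.memLp_F g hg
  have hεg : Integrable (fun ω => M.ε 0 ω * g (M.X 0 ω)) μ := h.memLp_ε.integrable_mul hgL
  rw [e1, e2, integral_lincomb h.memLp_ε.integrable_sq hεg hgL.integrable_sq, one_mul]

/-- The errors are orthogonal to the function space, as the target minimises the risk. -/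
lemma Standing.integral_ε_mul {g : M.𝒳 → ℝ} (hg : g ∈ M.F) :
    ∫ ω, M.ε 0 ω * g (M.X 0 ω) ∂μ = 0 := by
  -- The risk increment along `t • g` is a nonnegative quadratic without constant term, so its
  -- linear coefficient must vanish.
  have key : ∀ t : ℝ, 0 ≤ (∫ ω, g (M.X 0 ω) ^ 2 ∂μ) * (t * t)
      + (-2 * ∫ ω, M.ε 0 ω * g (M.X 0 ω) ∂μ) * t + 0 := by
    intro t
    have := h.f0_min _ (M.F.add_mem h.f0_mem (M.F.smul_mem t hg))
    rw [h.risk_add_smul hg] at this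
    linarith
  have := discrim_le_zero key
  unfold discrim at this
  have h2 : (∫ ω, M.ε 0 ω * g (M.X 0 ω) ∂μ) ^ 2 ≤ 0 := by linarith
  exact pow_eq_zero_iff two_ne_zero |>.1 (le_antisymm h2 (sq_nonneg _))

lemma Standing.excess_eq {f : M.𝒳 → ℝ} (hf : f ∈ M.F) : M.excess μ f = M.mse μ f := by
  have hg : f - M.f0 ∈ M.F := M.F.sub_mem hf h.f0_mem
  have := h.risk_add_smul hg 1
  rw [h.integral_ε_mul hg, one_smul, add_sub_cancel] at this
  unfold excess
  rw [this]
  simp [mse]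

lemma Standing.marginCondition (η : ℝ) : M.MarginCondition μ η sqMargin := by
  refine ⟨(even_two.strictConvexOn_pow two_ne_zero).subset (Set.subset_univ _) (convex_Ici 0),
    by simp [sqMargin], fun f hf => ?_⟩
  rw [h.excess_eq hf.1, mse_eq]
  rfl

lemma Standing.norm2_fn_sub_le (b c : Fin p → ℝ) :
    M.norm2 μ (M.fn (b - c)) ≤ M.norm2 μ (M.fn b - M.f0) + M.norm2 μ (M.fn c - M.f0) := by
  have e : M.norm2 μ (M.fn (b - c)) = √(∫ ω, ((M.fn b - M.f0) (M.X 0 ω)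
      - (M.fn c - M.f0) (M.X 0 ω)) ^ 2 ∂μ) := by
    unfold norm2
    simp [← fn_sub]
  rw [e]
  exact sqrt_integral_sub_sq_le (h.memLp_F _ (M.F.sub_mem (h.fn_mem b) h.f0_mem))
    (h.memLp_F _ (M.F.sub_mem (h.fn_mem c) h.f0_mem))

/-! ### The restricted eigenvalue -/

lemma Standing.integral_ψ_mul_fn (b : Fin p → ℝ) (j : Fin p) :
    ∫ ω, M.ψ j (M.X 0 ω) * M.fn b (M.X 0 ω) ∂μ = (M.cov μ).mulVec b j := by
  have e : (fun ω => M.ψ j (M.X 0 ω) * M.fn b (M.X 0 ω))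
      = fun ω => ∑ k, M.ψ j (M.X 0 ω) * M.ψ k (M.X 0 ω) * b k := by
    funext ω
    rw [fn, Finset.mul_sum]
    exact Finset.sum_congr rfl fun k _ => by ring
  rw [e, integral_finsetSum]
  · simp [Matrix.mulVec, dotProduct, cov, integral_mul_const]
  · intro k _
    exact ((h.memLp_F _ (h.ψ_mem j)).integrable_mul (h.memLp_F _ (h.ψ_mem k))).mul_const _

lemma Standing.norm2_fn_sq (b : Fin p → ℝ) :
    M.norm2 μ (M.fn b) ^ 2 = ∑ j, b j * (M.cov μ).mulVec b j := by
  rw [norm2_sq]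
  have e : (fun ω => M.fn b (M.X 0 ω) ^ 2)
      = fun ω => ∑ j, b j * (M.ψ j (M.X 0 ω) * M.fn b (M.X 0 ω)) := by
    funext ω
    simp only [← mul_assoc, ← Finset.sum_mul]
    rw [sq]
    rfl
  rw [e, integral_finsetSum]
  · exact Finset.sum_congr rfl fun j _ => by rw [integral_const_mul, h.integral_ψ_mul_fn]
  · intro j _
    exact ((h.memLp_F _ (h.ψ_mem j)).integrable_mul (h.memLp_F _ (h.fn_mem b))).const_mul _

/-- If `f_b` has norm zero, Cauchy–Schwarz against each `ψ j` gives `Σ b = 0`, and full rank makes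
`Σ` injective. -/
lemma Standing.norm2_fn_pos (hcov : (M.cov μ).rank = p) {b : Fin p → ℝ} (hb : b ≠ 0) :
    0 < M.norm2 μ (M.fn b) ^ 2 := by
  refine (sq_nonneg _).lt_of_ne fun h0 => hb ?_
  have hz : (M.cov μ).mulVec b = 0 := by
    funext j
    have := sq_integral_mul_le (h.memLp_F _ (h.ψ_mem j)) (h.memLp_F _ (h.fn_mem b))
    rw [← norm2_sq (M.fn b), ← h0, mul_zero, h.integral_ψ_mul_fn] at this
    exact pow_eq_zero_iff two_ne_zero |>.1 (le_antisymm this (sq_nonneg _))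
  have hli : LinearIndependent ℝ (M.cov μ).col := by
    rw [linearIndependent_iff_card_eq_finrank_span, Set.finrank, ← Matrix.rank_eq_finrank_span_cols,
      hcov, Fintype.card_fin]
  exact Matrix.mulVec_injective_iff.2 hli (by rw [hz, Matrix.mulVec_zero])

/-- The quadratic form `b' Σ b` is continuous and positive on the compact ℓ₂ unit sphere, hence has
a positive minimum there; homogeneity extends the bound. -/
lemma Standing.exists_eigenvalue_bound (hcov : (M.cov μ).rank = p) :
    ∃ c : ℝ, 0 < c ∧ ∀ b : Fin p → ℝ, c * l2 b ^ 2 ≤ M.norm2 μ (M.fn b) ^ 2 := by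
  set T : Set (Fin p → ℝ) := {b | l2 b ^ 2 = 1} with hT
  have hcont : Continuous fun b : Fin p → ℝ => M.norm2 μ (M.fn b) ^ 2 := by
    simp only [h.norm2_fn_sq, Matrix.mulVec, dotProduct]
    fun_prop
  have hTc : IsCompact T := by
    refine Metric.isCompact_of_isClosed_isBounded ?_ ?_
    · refine isClosed_eq ?_ continuous_const
      simp only [l2_sq]
      fun_prop
    · refine (Metric.isBounded_iff_subset_closedBall 0).2 ⟨1, fun b hb => ?_⟩
      rw [mem_closedBall_zero_iff, pi_norm_le_iff_of_nonneg zero_le_one]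
      intro j
      rw [Real.norm_eq_abs, ← sq_le_one_iff_abs_le_one]
      have hb1 : ∑ j, b j ^ 2 = 1 := by rw [← l2_sq]; exact hb
      rw [← hb1]
      exact Finset.single_le_sum (f := fun j => b j ^ 2) (fun _ _ => sq_nonneg _)
        (Finset.mem_univ j)
  have hscale : ∀ (t : ℝ) (b : Fin p → ℝ),
      M.norm2 μ (M.fn (t • b)) ^ 2 = t ^ 2 * M.norm2 μ (M.fn b) ^ 2 := by
    intro t b
    simp only [h.norm2_fn_sq, Matrix.mulVec_smul, Pi.smul_apply, smul_eq_mul, Finset.mul_sum]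
    exact Finset.sum_congr rfl fun j _ => by ring
  have hl2scale : ∀ (t : ℝ) (b : Fin p → ℝ), l2 (t • b) ^ 2 = t ^ 2 * l2 b ^ 2 := by
    intro t b
    simp only [l2_sq, Pi.smul_apply, smul_eq_mul, mul_pow, Finset.mul_sum]
  by_cases hne : T.Nonempty
  · obtain ⟨b0, hb0, hmin⟩ := hTc.exists_isMinOn hne hcont.continuousOn
    have hb0' : b0 ≠ 0 := by
      rintro rfl
      simp [hT, l2_sq] at hb0
    refine ⟨_, h.norm2_fn_pos hcov hb0', fun b => ?_⟩
    by_cases hb : b = 0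
    · subst hb
      simp only [l2_sq]
      simp [sq_nonneg]
    · have hpos := l2_pos hb
      have hmem : (l2 b)⁻¹ • b ∈ T := by
        change l2 ((l2 b)⁻¹ • b) ^ 2 = 1
        rw [hl2scale]
        field_simp
      have := hmin hmem
      simp only [Set.mem_ofPred_eq, hscale] at this
      calc _ ≤ ((l2 b)⁻¹ ^ 2 * M.norm2 μ (M.fn b) ^ 2) * l2 b ^ 2 := by gcongr
        _ = _ := by field_simp
  -- An empty sphere means that every vector is zero (`p = 0`), so any constant serves.
  · refine ⟨1, one_pos, fun b => ?_⟩
    have hb : l2 b = 0 := by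
      by_contra hb
      refine hne ⟨(l2 b)⁻¹ • b, ?_⟩
      change l2 ((l2 b)⁻¹ • b) ^ 2 = 1
      rw [hl2scale]
      field_simp
    rw [hb]
    simp [sq_nonneg]

omit h in
lemma phiSq_nonneg (lam1 lam2 : ℝ) (S : Finset (Fin p)) (β : Fin p → ℝ) :
    0 ≤ M.phiSq μ lam1 lam2 S β := by
  refine Real.sInf_nonneg ?_
  rintro _ ⟨b, -, rfl⟩
  positivity

omit h in
lemma phi_sq (lam1 lam2 : ℝ) (β : Fin p → ℝ) :
    M.phi μ lam1 lam2 β ^ 2 = M.phiSq μ lam1 lam2 (supp β) β :=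
  Real.sq_sqrt (phiSq_nonneg ..)

omit h in
lemma phi_nonneg (lam1 lam2 : ℝ) (β : Fin p → ℝ) : 0 ≤ M.phi μ lam1 lam2 β := Real.sqrt_nonneg _

/-- The cone contains `β`, so the infimum is not the default value for the empty set; every quotient
dominates the smallest-eigenvalue bound because `‖b_S‖₂ ≤ ‖b‖₂`. -/
lemma Standing.phi_pos (hcov : (M.cov μ).rank = p) {lam1 lam2 : ℝ} (h1 : 0 < lam1) (h2 : 0 ≤ lam2)
    {β : Fin p → ℝ} (hβ : β ≠ 0) : 0 < M.phi μ lam1 lam2 β := by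
  refine Real.sqrt_pos.2 ?_
  obtain ⟨c, hc, hcb⟩ := h.exists_eigenvalue_bound hcov
  refine hc.trans_le (le_csInf ⟨_, β, ⟨hβ, ?_⟩, rfl⟩ ?_)
  · have e : restr (supp β)ᶜ β = 0 := by
      funext j
      by_cases hj : β j = 0 <;> simp [restr, supp, hj]
    rw [e]
    have : l1 (0 : Fin p → ℝ) = 0 := by simp [l1]
    rw [this]
    have := l2_nonneg (restr (supp β) β)
    unfold Ln
    positivity
  · rintro _ ⟨b, ⟨hb, hcone⟩, rfl⟩
    -- In the cone `b_S = 0` forces `b_{Sᶜ} = 0`, so no quotient has a vanishing denominator.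
    have hpos : 0 < l2 (restr (supp β) b) := by
      refine (l2_nonneg _).lt_of_ne fun h0 => hb ?_
      rw [← h0, mul_zero] at hcone
      refine l1_eq_zero (le_antisymm ?_ (l1_nonneg b))
      rw [l1_eq_restr_add (supp β)]
      have := l1_restr_le (supp β) b
      rw [← h0, mul_zero] at this
      linarith
    simp only
    rw [le_div_iff₀ (by positivity)]
    refine le_trans ?_ (hcb b)
    have := l2_restr_le (supp β) b
    gcongr

omit h in
lemma phi_mul_le {lam1 lam2 : ℝ} {β b : Fin p → ℝ}
    (hcone : l1 (restr (supp β)ᶜ b) ≤ Ln lam1 lam2 (supp β) β * l2 (restr (supp β) b)) :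
    M.phi μ lam1 lam2 β * l2 (restr (supp β) b) ≤ M.norm2 μ (M.fn b) := by
  by_cases h0 : l2 (restr (supp β) b) = 0
  · rw [h0, mul_zero]
    exact norm2_nonneg _
  have hpos : 0 < l2 (restr (supp β) b) := (l2_nonneg _).lt_of_ne (Ne.symm h0)
  have hb : b ≠ 0 := by
    rintro rfl
    refine h0 ?_
    have : restr (supp β) (0 : Fin p → ℝ) = 0 := by
      funext j; simp [restr]
    simp [this, l2]
  refine le_of_sq_le_sq ?_ (norm2_nonneg _)
  rw [mul_pow, phi_sq, ← le_div_iff₀ (by positivity)]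
  refine csInf_le ⟨0, ?_⟩ ⟨b, ⟨hb, hcone⟩, rfl⟩
  rintro _ ⟨b, -, rfl⟩
  positivity

/-- A unit vector `e_j` with `j` in the support lies in the cone, and its quotient is `E ψ_j² ≤ K²`.
This upper bound later makes `Δ*` large enough to absorb the truncation bias. -/
lemma Standing.phi_le [IsProbabilityMeasure μ] {K : ℝ} (hK : ∀ j x, |M.ψ j x| ≤ K)
    {lam1 lam2 : ℝ} (h1 : 0 < lam1) (h2 : 0 ≤ lam2)
    {β : Fin p → ℝ} (hβ : β ≠ 0) : M.phi μ lam1 lam2 β ≤ K := by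
  obtain ⟨j, hj⟩ := supp_nonempty hβ
  have hK0 : 0 ≤ K := by
    obtain ⟨ω⟩ := nonempty_of_isProbabilityMeasure μ
    exact (abs_nonneg _).trans (hK j (M.X 0 ω))
  have hr : restr (supp β) (Pi.single j (1 : ℝ)) = Pi.single j 1 := by
    funext k
    by_cases hk : k = j
    · subst hk; simp [restr, hj]
    · simp [restr, hk]
  have hrc : restr (supp β)ᶜ (Pi.single j (1 : ℝ)) = 0 := by
    funext k
    by_cases hk : k = j
    · subst hk; simp [restr, hj]
    · simp [restr, hk]
  have hl : l2 (Pi.single j (1 : ℝ)) = 1 := by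
    simp [l2, Pi.single_apply, ite_pow]
  have := phi_mul_le (M := M) (μ := μ) (lam1 := lam1) (lam2 := lam2) (β := β)
    (b := Pi.single j 1) (by
      rw [hrc, hr, hl]
      have : l1 (0 : Fin p → ℝ) = 0 := by simp [l1]
      rw [this]
      have := l2_nonneg (restr (supp β) β)
      unfold Ln
      positivity)
  rw [hr, hl, mul_one] at this
  refine this.trans (Real.sqrt_le_iff.2 ⟨hK0, ?_⟩)
  have e : ∀ x, M.fn (Pi.single j 1) x = M.ψ j x := by
    intro x
    simp [fn, Pi.single_apply]
  simp only [e]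
  refine (integral_mono (h.memLp_F _ (h.ψ_mem j)).integrable_sq (integrable_const (K ^ 2))
    fun ω => ?_).trans (by simp)
  exact sq_le_sq' (neg_le_of_abs_le (hK _ _)) (le_of_abs_le (hK _ _))

end standing

/-! ### The oracle inequality for a given deviation of the empirical process -/

section oracle

variable {Ω : Type*} [MeasurableSpace Ω] {μ : Measure Ω} {n p : ℕ} [NeZero n] {M : Model Ω n p}
  {lam0 lam1 lam2 : ℝ} {βs : Fin p → ℝ}

lemma two_mul_ridge (hβ : βs ≠ 0)
    (hl2 : lam2 = lam1 * √((supp βs).card : ℝ) / (2 * l2 βs)) :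
    2 * (lam2 * l2 βs) = lam1 * √((supp βs).card : ℝ) := by
  have := (l2_pos hβ).ne'
  rw [hl2]
  field_simp

variable (h : M.Standing μ)
include h

/-- With the tuned ridge level the argument of the conjugate is `6 * lam1 * √s / φ = 2a`, and `H(2a)
= a²`. -/
lemma Standing.delta_eq (h1 : 0 < lam1) (hβ : βs ≠ 0)
    (hl2 : lam2 = lam1 * √((supp βs).card : ℝ) / (2 * l2 βs)) :
    M.delta μ sqMargin lam1 lam2 βs = 3 / 2 * M.norm2 μ (M.fn βs - M.f0) ^ 2
      + (3 * lam1 * √((supp βs).card : ℝ) / M.phi μ lam1 lam2 βs) ^ 2 := by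
  have hridge := two_mul_ridge hβ hl2
  have he : M.estArg μ lam1 lam2 βs
      = 2 * (3 * lam1 * √((supp βs).card : ℝ) / M.phi μ lam1 lam2 βs) := by
    unfold estArg
    rw [mul_div_assoc']
    congr 1
    linarith
  have hφ := phi_nonneg (M := M) (μ := μ) lam1 lam2 βs
  unfold delta
  rw [h.excess_eq (h.fn_mem βs), mse_eq, he, conjugate_sqMargin (by positivity)]
  ring

/-- Only the comparison of `β` with `βs` is used, not minimality of `β`, so that the result also
applies to convex combinations of the estimator and the oracle. -/
lemma Standing.deviation_bounds (h1 : 0 < lam1) (hβ : βs ≠ 0)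
    (hl2 : lam2 = lam1 * √((supp βs).card : ℝ) / (2 * l2 βs))
    (hφ : 0 < M.phi μ lam1 lam2 βs) {ω : Ω} {β : Fin p → ℝ}
    (hdev : |M.V μ β ω - M.V μ βs ω| ≤ M.delta μ sqMargin lam1 lam2 βs)
    (hmin : M.empRisk (M.fn β) ω + lam1 * l1 β + lam2 * l2 β ^ 2
      ≤ M.empRisk (M.fn βs) ω + lam1 * l1 βs + lam2 * l2 βs ^ 2) :
    M.mse μ (M.fn β) + lam1 * l1 (β - βs) + lam2 * l2 (restr (supp βs) (β - βs)) ^ 2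
        ≤ 4 * M.delta μ sqMargin lam1 lam2 βs
      ∧ lam1 * l1 (β - βs) ≤ 3 * M.delta μ sqMargin lam1 lam2 βs := by
  have hridge := two_mul_ridge hβ hl2
  have hl20 : 0 ≤ lam2 := by
    have := l2_nonneg βs
    rw [hl2]; positivity
  have hpen := penalty_sub_le h1.le hl20 βs β
  have hD := h.delta_eq h1 hβ hl2
  set S := supp βs with hS
  set δ := β - βs with hδ
  have hexc : M.risk μ (M.fn β) - M.risk μ (M.fn βs)
      = M.norm2 μ (M.fn β - M.f0) ^ 2 - M.norm2 μ (M.fn βs - M.f0) ^ 2 := by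
    have e1 := h.excess_eq (h.fn_mem β)
    have e2 := h.excess_eq (h.fn_mem βs)
    rw [mse_eq] at e1 e2
    rw [← e1, ← e2]
    unfold excess
    ring
  have hx := l1_restr_le S δ
  have hrz : 0 ≤ √(S.card : ℝ) * l2 (restr S δ) := (l1_nonneg _).trans hx
  have hx' := mul_le_mul_of_nonneg_left hx h1.le
  have hinner : 2 * lam2 * (l2 βs * l2 (restr S δ))
      = lam1 * (√(S.card : ℝ) * l2 (restr S δ)) := by
    rw [← mul_assoc lam1, ← hridge]; ring
  have hV := neg_le_of_abs_le hdev
  rw [V_eq, V_eq] at hV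
  rw [l1_eq_restr_add S δ, mse_eq]
  refine cone_dichotomy h1 hl20 (l1_nonneg _) hx hrz hD (by linarith) fun hcone => ?_
  -- The tuned `lam2` doubles `√s` inside `Ln`, so the cone of the eigenvalue is exactly the one of
  -- the case distinction.
  have hLn : Ln lam1 lam2 S βs = 6 * √(S.card : ℝ) := by
    unfold Ln
    rw [hS, restr_supp, mul_assoc, hridge]
    field_simp
    ring
  have hp := phi_mul_le (M := M) (μ := μ) (lam1 := lam1) (lam2 := lam2) (β := βs) (b := δ)
    (by rw [← hS, hLn]; linarith)
  have hmink := hp.trans (h.norm2_fn_sub_le β βs)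
  calc 3 * (lam1 * (√(S.card : ℝ) * l2 (restr S δ)))
      = 3 * lam1 * √(S.card : ℝ) / M.phi μ lam1 lam2 βs
        * (M.phi μ lam1 lam2 βs * l2 (restr S δ)) := by field_simp
    _ ≤ _ := mul_le_mul_of_nonneg_left hmink (by positivity)

/-- The deviation is required only on `M.Φ`: part (b) controls the process only where `l1 β ≤ B`,
whereas `tau` involves the whole ball. -/
lemma Standing.oracleInequality_of_deviation {L : ℝ} (h0 : 0 < lam0) (h8 : 8 * lam0 ≤ lam1)
    (hL : lam1 ≤ L * lam0) (hβ : βs ≠ 0)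
    (hl2 : lam2 = lam1 * √((supp βs).card : ℝ) / (2 * l2 βs))
    (hφ : 0 < M.phi μ lam1 lam2 βs) (hΦ : βs ∈ M.Φ) {ω : Ω} {b : Fin p → ℝ}
    (hb : M.IsElasticNet lam1 lam2 ω b)
    (hdev : ∀ β ∈ M.Φ, l1 (β - βs) ≤ M.Mstar μ sqMargin lam0 lam1 lam2 βs →
      |M.V μ β ω - M.V μ βs ω| ≤ M.delta μ sqMargin lam1 lam2 βs) :
    M.OracleInequality μ L lam0 lam1 lam2 βs b := by
  have h1 : 0 < lam1 := by linarith
  have hl20 : 0 ≤ lam2 := by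
    have := l2_nonneg βs
    rw [hl2]; positivity
  have hD := h.delta_eq h1 hβ hl2
  have hs : 0 < ((supp βs).card : ℝ) := Nat.cast_pos.2 (supp_nonempty hβ).card_pos
  have hDpos : 0 < M.delta μ sqMargin lam1 lam2 βs := by
    rw [hD]; positivity
  have hM : M.delta μ sqMargin lam1 lam2 βs = lam0 * M.Mstar μ sqMargin lam0 lam1 lam2 βs := by
    unfold Mstar
    field_simp
  have hMpos : 0 < M.Mstar μ sqMargin lam0 lam1 lam2 βs := div_pos hDpos h0
  set D := M.delta μ sqMargin lam1 lam2 βs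
  set R := M.Mstar μ sqMargin lam0 lam1 lam2 βs
  have hclose : l1 (b - βs) ≤ R := by
    have hd := l1_nonneg (b - βs)
    -- This weight puts `c` in the ball whatever `b` is. The bound `3 * D = 3 * lam0 * R` with `8 *
    -- lam0 ≤ lam1` gives `l1 (c - βs) ≤ 3/8 * R ≤ R / 2`, and `t * l ≤ R / 2` is equivalent to `l ≤
    -- R` for `l = l1 (b - βs)`.
    set t := R / (R + l1 (b - βs)) with ht
    have ht0 : 0 ≤ t := by positivity
    have ht1 : t ≤ 1 := (div_le_one (by positivity)).2 (by linarith)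
    set c := t • b + (1 - t) • βs with hc
    have hcsub : c - βs = t • (b - βs) := by
      rw [hc, smul_sub, sub_smul, one_smul]; abel
    have hcl : l1 (c - βs) = t * l1 (b - βs) := by rw [hcsub, l1_smul, abs_of_nonneg ht0]
    have htR : t * (R + l1 (b - βs)) = R := div_mul_cancel₀ _ (by positivity)
    have hcR : l1 (c - βs) ≤ R := by
      rw [hcl]; nlinarith
    have hcΦ : c ∈ M.Φ := h.convex_Φ hb.1 hΦ ht0 (sub_nonneg.2 ht1) (by ring)
    have hmin := mul_le_mul_of_nonneg_left (hb.2 βs hΦ) ht0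
    have e1 := M.empRisk_convex ht0 ht1 b βs ω
    have e2 := mul_le_mul_of_nonneg_left (l1_convex ht0 ht1 b βs) h1.le
    have e3 := mul_le_mul_of_nonneg_left (l2_sq_convex ht0 ht1 b βs) hl20
    have := (h.deviation_bounds h1 hβ hl2 hφ (hdev c hcΦ hcR) (by rw [← hc] at e1 e2 e3; nlinarith)).2
    have h3 : lam1 * l1 (c - βs) ≤ 3 * D := this
    have h4 : 8 * lam0 * l1 (c - βs) ≤ lam1 * l1 (c - βs) :=
      mul_le_mul_of_nonneg_right h8 (l1_nonneg _)
    have h5 : l1 (c - βs) ≤ R / 2 := by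
      rw [hM] at h3
      have : lam0 * l1 (c - βs) ≤ lam0 * (R / 2) := by nlinarith
      exact le_of_mul_le_mul_left this h0
    rw [hcl] at h5
    by_contra hlt
    rw [not_le] at hlt
    have htpos : 0 < t := div_pos hMpos (by positivity)
    nlinarith [mul_pos htpos (sub_pos.2 hlt)]
  have hfin := (h.deviation_bounds h1 hβ hl2 hφ (hdev b hb.1 hclose) (hb.2 βs hΦ)).1
  unfold OracleInequality
  rw [← restr_sub]
  refine hfin.trans ?_
  change 4 * D ≤ _
  rw [hD, mse_eq, div_pow, mul_pow, mul_pow, Real.sq_sqrt hs.le]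
  have : lam1 ^ 2 ≤ L ^ 2 * lam0 ^ 2 := by rw [← mul_pow]; gcongr
  have h2 : (3 ^ 2 * lam1 ^ 2 * ((supp βs).card : ℝ)) / M.phi μ lam1 lam2 βs ^ 2
      ≤ 3 ^ 2 * (L ^ 2 * lam0 ^ 2) * ((supp βs).card : ℝ) / M.phi μ lam1 lam2 βs ^ 2 := by
    gcongr
  have h3 : 36 * L ^ 2 * lam0 ^ 2 * ((supp βs).card : ℝ) / M.phi μ lam1 lam2 βs ^ 2
      = 4 * (3 ^ 2 * (L ^ 2 * lam0 ^ 2) * ((supp βs).card : ℝ) / M.phi μ lam1 lam2 βs ^ 2) := by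
    ring
  rw [h3]
  linarith

/-- Functions with coefficients near the oracle stay in the local set. -/
lemma Standing.fn_mem_localSet {K η L : ℝ} (hK : ∀ j x, |M.ψ j x| ≤ K) (hK0 : 0 < K) (hη : 0 < η)
    (h0 : 0 < lam0) (h1 : 0 < lam1) (hL : lam1 ≤ L * lam0) (hβ : βs ≠ 0)
    (hl2 : lam2 = lam1 * √((supp βs).card : ℝ) / (2 * l2 βs))
    (hφ : 0 < M.phi μ lam1 lam2 βs)
    (hsmall : 36 * L ^ 2 * lam0 * ((supp βs).card : ℝ) * K / (η * M.phi μ lam1 lam2 βs ^ 2) ≤ 1)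
    (happrox : ∀ x, |M.fn βs x - M.f0 x| ≤ η / 2)
    (hmse : 3 / 2 * M.mse μ (M.fn βs)
      ≤ 9 * lam1 ^ 2 * ((supp βs).card : ℝ) / M.phi μ lam1 lam2 βs ^ 2)
    {β : Fin p → ℝ} (hR : l1 (β - βs) ≤ M.Mstar μ sqMargin lam0 lam1 lam2 βs) :
    M.fn β ∈ M.localSet η := by
  refine ⟨h.fn_mem β, fun x => ?_⟩
  have hD := h.delta_eq h1 hβ hl2
  have hs : 0 < ((supp βs).card : ℝ) := Nat.cast_pos.2 (supp_nonempty hβ).card_pos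
  rw [div_pow, mul_pow, mul_pow, Real.sq_sqrt hs.le, ← mse_eq] at hD
  -- The hypothesis on the approximation error says `3/2 * v² ≤ a²`, hence `Δ* ≤ 2a²`.
  have hDle : M.delta μ sqMargin lam1 lam2 βs
      ≤ 18 * (L ^ 2 * lam0 ^ 2) * ((supp βs).card : ℝ) / M.phi μ lam1 lam2 βs ^ 2 := by
    have : lam1 ^ 2 ≤ L ^ 2 * lam0 ^ 2 := by rw [← mul_pow]; gcongr
    calc _ ≤ 18 * lam1 ^ 2 * ((supp βs).card : ℝ) / M.phi μ lam1 lam2 βs ^ 2 := by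
          rw [hD]
          have : 18 * lam1 ^ 2 * ((supp βs).card : ℝ) / M.phi μ lam1 lam2 βs ^ 2
            = 2 * (9 * lam1 ^ 2 * ((supp βs).card : ℝ) / M.phi μ lam1 lam2 βs ^ 2) := by ring
          rw [this]
          have e : (3 : ℝ) ^ 2 = 9 := by norm_num
          rw [e]
          linarith
      _ ≤ _ := by gcongr
  have hMK : M.Mstar μ sqMargin lam0 lam1 lam2 βs * K ≤ η / 2 := by
    unfold Mstar
    rw [div_le_one (by positivity)] at hsmall
    have e : M.delta μ sqMargin lam1 lam2 βs / lam0 * K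
        ≤ (18 * (L ^ 2 * lam0 ^ 2) * ((supp βs).card : ℝ) / M.phi μ lam1 lam2 βs ^ 2) / lam0 * K := by
      gcongr
    refine e.trans ?_
    have e2 : (18 * (L ^ 2 * lam0 ^ 2) * ((supp βs).card : ℝ) / M.phi μ lam1 lam2 βs ^ 2) / lam0 * K
        = (36 * L ^ 2 * lam0 * ((supp βs).card : ℝ) * K) / M.phi μ lam1 lam2 βs ^ 2 / 2 := by
      field_simp
      ring
    rw [e2]
    have : (36 * L ^ 2 * lam0 * ((supp βs).card : ℝ) * K) / M.phi μ lam1 lam2 βs ^ 2 ≤ η :=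
      (div_le_iff₀ (by positivity)).2 hsmall
    linarith
  have hfn := abs_fn_le hK (β - βs) x
  rw [← fn_sub] at hfn
  have hfn2 := hfn.trans ((mul_le_mul_of_nonneg_right hR hK0.le).trans hMK)
  have := abs_add_le (M.fn β x - M.fn βs x) (M.fn βs x - M.f0 x)
  rw [sub_add_sub_cancel] at this
  linarith [happrox x]

end oracle

end Model

/-! ### Tail integrals and concentration of empirical averages. -/

lemma l1_mul_l1 {p : ℕ} (b c : Fin p → ℝ) :
    ∑ i : Fin p × Fin p, |b i.1 * c i.2| = l1 b * l1 c := by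
  simp only [l1, abs_mul, Fintype.sum_prod_type, Finset.sum_mul_sum]

/-- The expected overshoot of a sub-gaussian variable over a level. -/
lemma SubGaussianTail.integral_overshoot_le {Ω : Type*} [MeasurableSpace Ω] {μ : Measure Ω}
    [IsProbabilityMeasure μ] {V : Ω → ℝ} {α δ : ℝ} (hV : SubGaussianTail μ V α δ)
    (hint : Integrable V μ) {C : ℝ} (hC : 0 < C) :
    ∫ ω, max (|V ω| - C) 0 ∂μ ≤ α * Real.exp (-δ * C ^ 2) / (2 * δ * C) := by
  obtain ⟨hα, hδ, hV⟩ := hV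
  have hint' : Integrable (fun ω => max (|V ω| - C) 0) μ :=
    ((hint.abs.sub (integrable_const C)).sup (integrable_const 0))
  rw [hint'.integral_eq_integral_meas_lt (.of_forall fun ω => le_max_right _ _)]
  have ha : -(2 * δ * C) < 0 := by
    have : 0 < δ * C := mul_pos hδ hC
    linarith
  have hle : ∀ t ∈ Set.Ioi (0 : ℝ), μ.real {ω | t < max (|V ω| - C) 0}
      ≤ α * Real.exp (-δ * C ^ 2) * Real.exp (-(2 * δ * C) * t) := by
    intro t ht
    have ht : 0 < t := ht
    calc μ.real {ω | t < max (|V ω| - C) 0} ≤ μ.real {ω | C + t ≤ |V ω|} := by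
          refine measureReal_mono fun ω hω => ?_
          rcases lt_max_iff.1 (show t < max (|V ω| - C) 0 from hω) with h | h
          · change C + t ≤ |V ω|
            linarith
          · exact absurd h ht.le.not_gt
      _ ≤ α * Real.exp (-δ * (C + t) ^ 2) := hV _ (by positivity)
      -- Dropping `-δ * t²` leaves an exponential in `t` that integrates in closed form.
      _ ≤ α * Real.exp (-δ * C ^ 2 + -(2 * δ * C) * t) := by
          gcongr
          nlinarith [mul_nonneg hδ.le (sq_nonneg t)]
      _ = _ := by rw [Real.exp_add]; ring
  calc ∫ t in Set.Ioi (0 : ℝ), μ.real {ω | t < max (|V ω| - C) 0}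
      ≤ ∫ t in Set.Ioi (0 : ℝ), α * Real.exp (-δ * C ^ 2) * Real.exp (-(2 * δ * C) * t) := by
        refine integral_mono_of_nonneg (.of_forall fun _ => measureReal_nonneg)
          ((integrableOn_exp_mul_Ioi ha 0).const_mul _) ?_
        filter_upwards [ae_restrict_mem measurableSet_Ioi] with t ht using hle t ht
    _ = _ := by
        rw [integral_const_mul, integral_exp_mul_Ioi ha, mul_zero, Real.exp_zero, neg_div_neg_eq,
          mul_one_div]

namespace Model

section deviation

variable {Ω : Type*} [MeasurableSpace Ω] {μ : Measure Ω} {n p : ℕ} [NeZero n] {M : Model Ω n p}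

variable (M μ) in
/-- The centred empirical average of a function of the observations. -/
noncomputable def dev (g : M.𝒳 × ℝ → ℝ) (ω : Ω) : ℝ :=
  (1 / (n : ℝ)) * ∑ i, g (M.X i ω, M.Y i ω) - ∫ ω', g (M.X 0 ω', M.Y 0 ω') ∂μ

lemma dev_sum {ι : Type*} [Fintype ι] {g : ι → M.𝒳 × ℝ → ℝ}
    (hg : ∀ k, Integrable (fun ω => g k (M.X 0 ω, M.Y 0 ω)) μ) (c : ι → ℝ) (ω : Ω) :
    M.dev μ (fun z => ∑ k, c k * g k z) ω = ∑ k, c k * M.dev μ (g k) ω := by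
  unfold dev
  rw [integral_finsetSum _ fun k _ => (hg k).const_mul _, Finset.sum_comm, Finset.mul_sum,
    ← Finset.sum_sub_distrib]
  refine Finset.sum_congr rfl fun k _ => ?_
  rw [integral_const_mul, ← Finset.mul_sum]
  ring

/-- This ℓ₁–ℓ∞ duality replaces a supremum over coefficient vectors by a maximum over finitely many
averages. -/
lemma abs_dev_sum_le {ι : Type*} [Fintype ι] {g : ι → M.𝒳 × ℝ → ℝ}
    (hg : ∀ k, Integrable (fun ω => g k (M.X 0 ω, M.Y 0 ω)) μ) (c : ι → ℝ) {ω : Ω} {r : ℝ}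
    (hr : ∀ k, |M.dev μ (g k) ω| ≤ r) :
    |M.dev μ (fun z => ∑ k, c k * g k z) ω| ≤ (∑ k, |c k|) * r := by
  rw [dev_sum hg, Finset.sum_mul]
  refine (Finset.abs_sum_le_sum_abs _ _).trans (Finset.sum_le_sum fun k _ => ?_)
  rw [abs_mul]
  exact mul_le_mul_of_nonneg_left (hr k) (abs_nonneg _)

variable (h : M.Standing μ)
include h

lemma Standing.V_sub_eq [IsProbabilityMeasure μ] (b c : Fin p → ℝ) (ω : Ω) :
    M.V μ b ω - M.V μ c ω = -2 * M.dev μ (fun z => z.2 * M.fn (b - c) z.1) ω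
      + M.dev μ (fun z => M.fn (b - c) z.1 * M.fn (b + c) z.1) ω := by
  have hYf : Integrable (fun ω => M.Y 0 ω * M.fn (b - c) (M.X 0 ω)) μ :=
    h.memLp_Y.integrable_mul (h.memLp_F _ (h.fn_mem _))
  have hff : Integrable (fun ω => M.fn (b - c) (M.X 0 ω) * M.fn (b + c) (M.X 0 ω)) μ :=
    (h.memLp_F _ (h.fn_mem _)).integrable_mul (h.memLp_F _ (h.fn_mem _))
  have hl : ∀ b', Integrable (fun ω => (M.Y 0 ω - M.fn b' (M.X 0 ω)) ^ 2) μ := fun b' =>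
    (h.memLp_Y.sub (h.memLp_F _ (h.fn_mem b'))).integrable_sq
  have hpt : ∀ x y, M.loss (M.fn b) x y
      = 1 * M.loss (M.fn c) x y + -2 * (y * M.fn (b - c) x)
        + 1 * (M.fn (b - c) x * M.fn (b + c) x) := by
    intro x y
    unfold loss
    rw [← fn_sub, ← fn_add]
    ring
  have hrisk : M.risk μ (M.fn b) = 1 * M.risk μ (M.fn c)
      + -2 * ∫ ω, M.Y 0 ω * M.fn (b - c) (M.X 0 ω) ∂μ
      + 1 * ∫ ω, M.fn (b - c) (M.X 0 ω) * M.fn (b + c) (M.X 0 ω) ∂μ := by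
    rw [h.risk_eq (h.fn_mem b), h.risk_eq (h.fn_mem c), ← integral_lincomb (hl c) hYf hff]
    exact integral_congr_ae (.of_forall fun ω => hpt _ _)
  have hemp : M.empRisk (M.fn b) ω = M.empRisk (M.fn c) ω
      + -2 * ((1 / (n : ℝ)) * ∑ i, M.Y i ω * M.fn (b - c) (M.X i ω))
      + (1 / (n : ℝ)) * ∑ i, M.fn (b - c) (M.X i ω) * M.fn (b + c) (M.X i ω) := by
    unfold empRisk
    simp only [hpt _ _, Finset.sum_add_distrib, ← Finset.mul_sum]
    ring
  rw [V_eq, V_eq, hrisk, hemp]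
  unfold dev
  ring

/-- Hoeffding's inequality for the average of a bounded function of the observations. -/
lemma Standing.measureReal_dev_le [IsProbabilityMeasure μ] {g : M.𝒳 × ℝ → ℝ} (hg : Measurable g)
    {R : ℝ} (hR : 0 < R) (hb : ∀ z, |g z| ≤ R) {s : ℝ} (hs : 0 ≤ s) :
    μ.real {ω | R * s ≤ |M.dev μ g ω|} ≤ 2 * Real.exp (-(n * s ^ 2 / 2)) := by
  have hn : (0 : ℝ) < n := Nat.cast_pos.2 (NeZero.pos n)
  have key : ∀ g : M.𝒳 × ℝ → ℝ, Measurable g → (∀ z, |g z| ≤ R) →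
      μ.real {ω | R * s ≤ M.dev μ g ω} ≤ Real.exp (-(n * s ^ 2 / 2)) := by
    intro g hg hb
    set e := ∫ ω, g (M.X 0 ω, M.Y 0 ω) ∂μ with he
    have hind : iIndepFun (fun i ω => g (M.X i ω, M.Y i ω) - e) μ :=
      h.indep.comp (fun _ z => g z - e) fun _ => hg.sub_const e
    have hsub : ∀ i ∈ (Finset.univ : Finset (Fin n)),
        HasSubgaussianMGF (fun ω => g (M.X i ω, M.Y i ω) - e) ((‖R - -R‖₊ / 2) ^ 2) μ := by
      intro i _
      have hm : Measurable fun ω => g (M.X i ω, M.Y i ω) :=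
        hg.comp ((h.measurable_X i).prodMk (h.measurable_Y i))
      have := hasSubgaussianMGF_of_mem_Icc hm.aemeasurable (μ := μ) (a := -R) (b := R)
        (.of_forall fun ω => abs_le.1 (hb _))
      rwa [h.integral_pair hg i] at this
    have hc : (((‖R - -R‖₊ / 2) ^ 2 : NNReal) : ℝ) = R ^ 2 := by
      simp only [NNReal.coe_pow, NNReal.coe_div, coe_nnnorm, Real.norm_eq_abs, NNReal.coe_ofNat]
      rw [abs_of_pos (by linarith)]
      ring
    have := HasSubgaussianMGF.measure_sum_ge_le_of_iIndepFun hind hsub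
      (ε := n * (R * s)) (by positivity)
    rw [Finset.sum_const, Finset.card_univ, Fintype.card_fin, nsmul_eq_mul] at this
    have hexp : -(n * (R * s)) ^ 2 / (2 * (n * (((‖R - -R‖₊ / 2) ^ 2 : NNReal) : ℝ)))
        = -(n * s ^ 2 / 2) := by
      rw [hc]
      field_simp
    rw [← hexp]
    refine le_trans (measureReal_mono fun ω hω => ?_) this
    have hω : R * s ≤ M.dev μ g ω := hω
    change n * (R * s) ≤ ∑ i, (g (M.X i ω, M.Y i ω) - e)
    have e2 : ∑ i, (g (M.X i ω, M.Y i ω) - e) = n * M.dev μ g ω := by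
      unfold dev
      rw [Finset.sum_sub_distrib, Finset.sum_const, Finset.card_univ, Fintype.card_fin,
        nsmul_eq_mul, ← he]
      field_simp
    rw [e2]
    gcongr
  have hneg : ∀ ω, M.dev μ (fun z => -g z) ω = -M.dev μ g ω := by
    intro ω
    unfold dev
    rw [Finset.sum_neg_distrib, integral_neg]
    ring
  have h1 := key g hg hb
  have h2 := key (fun z => -g z) hg.neg fun z => by rw [abs_neg]; exact hb z
  have hsubset : {ω | R * s ≤ |M.dev μ g ω|}
      ⊆ {ω | R * s ≤ M.dev μ g ω} ∪ {ω | R * s ≤ M.dev μ (fun z => -g z) ω} := by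
    intro ω hω
    rcases le_abs.1 (show R * s ≤ |M.dev μ g ω| from hω) with hh | hh
    · exact Or.inl hh
    · exact Or.inr (by change R * s ≤ M.dev μ (fun z => -g z) ω; rwa [hneg])
  linarith [(measureReal_mono hsubset).trans (measureReal_union_le (μ := μ) _ _)]

/-- The factor 4 turns the Hoeffding exponent into `8 * log p`, leaving ample room for a union over
`p + p²` averages. -/
lemma Standing.measureReal_exists_dev_le [IsProbabilityMeasure μ] {ι : Type*} [Fintype ι]
    {g : ι → M.𝒳 × ℝ → ℝ} (hg : ∀ k, Measurable (g k)) {R : ℝ} (hR : 0 < R)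
    (hb : ∀ k z, |g k z| ≤ R) (hp : 1 ≤ p) :
    μ.real {ω | ∃ k, R * (4 * √(Real.log p / n)) ≤ |M.dev μ (g k) ω|}
      ≤ Fintype.card ι * (2 / (p : ℝ) ^ 8) := by
  have hp0 : (0 : ℝ) < p := Nat.cast_pos.2 hp
  have hn : (0 : ℝ) < n := Nat.cast_pos.2 (NeZero.pos n)
  have hlog : 0 ≤ Real.log p := Real.log_nonneg (by exact_mod_cast hp)
  have hexp : Real.exp (-(n * (4 * √(Real.log p / n)) ^ 2 / 2)) = 1 / (p : ℝ) ^ 8 := by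
    rw [mul_pow, Real.sq_sqrt (by positivity)]
    have : -(n * (4 ^ 2 * (Real.log p / n)) / 2) = -(8 * Real.log p) := by
      field_simp
      ring
    rw [this, Real.exp_neg, one_div, inv_inj]
    have h8 : (8 : ℝ) * Real.log p = Real.log ((p : ℝ) ^ 8) := by
      rw [Real.log_pow]; norm_num
    rw [h8, Real.exp_log (by positivity)]
  have hU : {ω | ∃ k, R * (4 * √(Real.log p / n)) ≤ |M.dev μ (g k) ω|}
      = ⋃ k, {ω | R * (4 * √(Real.log p / n)) ≤ |M.dev μ (g k) ω|} := by
    ext ω; simp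
  rw [hU]
  refine (measureReal_iUnion_fintype_le _).trans ?_
  refine (Finset.sum_le_sum fun k _ => h.measureReal_dev_le (hg k) hR (hb k)
    (by positivity)).trans ?_
  rw [hexp, Finset.sum_const, Finset.card_univ, nsmul_eq_mul]
  exact le_of_eq (by ring)

end deviation

/-! ### Boundedness of the local supremum -/

section tau

variable {Ω : Type*} [MeasurableSpace Ω] {μ : Measure Ω} [IsProbabilityMeasure μ] {n p : ℕ}
  [NeZero n] {M : Model Ω n p}

/-- The supremum of an unbounded set of reals is `0` by convention, so the point is boundedness: at
fixed `ω` the increments are at most a constant times the ℓ₁ distance. -/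
lemma Standing.abs_V_sub_le_Z (h : M.Standing μ) {K : ℝ} (hK : ∀ j x, |M.ψ j x| ≤ K)
    {βs β : Fin p → ℝ} {R : ℝ} (hR : l1 (β - βs) ≤ R) (ω : Ω) :
    |M.V μ β ω - M.V μ βs ω| ≤ M.Z μ βs R ω := by
  refine le_csSup ?_ ⟨β, hR, rfl⟩
  set C : ℝ := 2 * ((1 / (n : ℝ)) * ∑ i : Fin n, |M.Y i ω| * |K|)
    + 2 * ∫ ω', |M.Y 0 ω'| * |K| ∂μ + 2 * (|K| * |K| * (R + 2 * l1 βs)) with hC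
  refine ⟨R * C, ?_⟩
  rintro _ ⟨b, hb, rfl⟩
  have hb : l1 (b - βs) ≤ R := hb
  have hδ := l1_nonneg (b - βs)
  have hn : (0 : ℝ) < n := Nat.cast_pos.2 (NeZero.pos n)
  have hfn : ∀ (c : Fin p → ℝ) x, |M.fn c x| ≤ l1 c * |K| := fun c x =>
    abs_fn_le (fun j x => (hK j x).trans (le_abs_self K)) c x
  have hsum : l1 (b + βs) ≤ R + 2 * l1 βs := by
    have e : b + βs = (b - βs) + (βs + βs) := by abel
    rw [e]
    linarith [l1_add_le (b - βs) (βs + βs), l1_add_le βs βs]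
  have hdev : ∀ (g : M.𝒳 × ℝ → ℝ) (G : M.𝒳 × ℝ → ℝ), (∀ z, |g z| ≤ l1 (b - βs) * G z) →
      Integrable (fun ω => G (M.X 0 ω, M.Y 0 ω)) μ →
      |M.dev μ g ω| ≤ l1 (b - βs) * ((1 / (n : ℝ)) * ∑ i, G (M.X i ω, M.Y i ω)
        + ∫ ω', G (M.X 0 ω', M.Y 0 ω') ∂μ) := by
    intro g G hgG hG
    unfold dev
    refine (abs_sub _ _).trans ?_
    rw [mul_add]
    refine add_le_add ?_ ?_
    · rw [abs_mul, abs_of_nonneg (by positivity), mul_left_comm, Finset.mul_sum]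
      gcongr
      exact (Finset.abs_sum_le_sum_abs _ _).trans (Finset.sum_le_sum fun i _ => hgG _)
    · rw [← integral_const_mul]
      refine (abs_integral_le_integral_abs).trans ?_
      exact integral_mono_of_nonneg (.of_forall fun _ => abs_nonneg _) (hG.const_mul _)
        (.of_forall fun _ => hgG _)
  have hYint : Integrable (fun ω => |M.Y 0 ω| * |K|) μ :=
    ((h.memLp_Y.integrable one_le_two).abs).mul_const _
  have d1 := hdev (fun z => z.2 * M.fn (b - βs) z.1) (fun z => |z.2| * |K|) (fun z => by
    rw [abs_mul, mul_left_comm]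
    exact mul_le_mul_of_nonneg_left (hfn _ _) (abs_nonneg _)) hYint
  have d2 := hdev (fun z => M.fn (b - βs) z.1 * M.fn (b + βs) z.1)
    (fun _ => |K| * |K| * (R + 2 * l1 βs)) (fun z => by
    rw [abs_mul]
    calc |M.fn (b - βs) z.1| * |M.fn (b + βs) z.1|
        ≤ (l1 (b - βs) * |K|) * ((R + 2 * l1 βs) * |K|) := by
          refine mul_le_mul (hfn _ _) ((hfn _ _).trans ?_) (abs_nonneg _) (by positivity)
          gcongr
      _ = _ := by ring) (integrable_const _)
  simp only [Finset.sum_const, Finset.card_univ, Fintype.card_fin, nsmul_eq_mul,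
    integral_const, probReal_univ, one_smul] at d2
  have e2 : 1 / (n : ℝ) * (n * (|K| * |K| * (R + 2 * l1 βs))) = |K| * |K| * (R + 2 * l1 βs) := by
    field_simp
  rw [e2] at d2
  have hI : 0 ≤ ∫ ω', |M.Y 0 ω'| * |K| ∂μ := integral_nonneg fun _ => by positivity
  have hl := l1_nonneg βs
  have hR0 : 0 ≤ R := hδ.trans hb
  have hC0 : 0 ≤ C := by
    rw [hC]
    positivity
  change |M.V μ b ω - M.V μ βs ω| ≤ R * C
  rw [h.V_sub_eq]
  calc _ ≤ 2 * |M.dev μ (fun z => z.2 * M.fn (b - βs) z.1) ω|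
        + |M.dev μ (fun z => M.fn (b - βs) z.1 * M.fn (b + βs) z.1) ω| := by
        refine (abs_add_le _ _).trans (le_of_eq ?_)
        rw [abs_mul]
        norm_num
    _ ≤ l1 (b - βs) * C := by
        simp only at d1
        rw [hC]
        linarith
    _ ≤ R * C := by gcongr

end tau

/-! ### Truncation -/

section truncation

variable {Ω : Type*} {n p : ℕ} {M : Model Ω n p}

variable (M) in
/-- The observations whose covariate and error are bounded by `C`. -/
def truncSet (C : ℝ) : Set (M.𝒳 × ℝ) := {z | |(z.1 : ℝ)| ≤ C ∧ |z.2 - M.f0 z.1| ≤ C}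

lemma ε_eq (i : Fin n) (ω : Ω) : M.Y i ω - M.f0 (M.X i ω) = M.ε i ω := by simp [Y]

variable (M) in
open Classical in
/-- The response, set to zero outside of the truncation set. -/
noncomputable def truncY (C : ℝ) (z : M.𝒳 × ℝ) : ℝ := if z ∈ M.truncSet C then z.2 else 0

lemma abs_truncY_le {C F : ℝ} (hC : 0 ≤ C) (hF0 : 0 ≤ F)
    (hF : ∀ x : M.𝒳, |(x : ℝ)| ≤ C → |M.f0 x| ≤ F) (z : M.𝒳 × ℝ) :
    |M.truncY C z| ≤ C + F := by
  unfold truncY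
  split_ifs with hz
  · have := abs_add_le (z.2 - M.f0 z.1) (M.f0 z.1)
    rw [sub_add_cancel] at this
    linarith [hz.2, hF z.1 hz.1]
  · rw [abs_zero]; positivity

variable [NeZero n]

variable (M) in
open Classical in
/-- The indicator of the complement of the truncation set, at the first observation. -/
noncomputable def tailInd (C : ℝ) (ω : Ω) : ℝ :=
  if (M.X 0 ω, M.Y 0 ω) ∈ M.truncSet C then 0 else 1

lemma tailInd_mem (C : ℝ) (ω : Ω) : 0 ≤ M.tailInd C ω ∧ M.tailInd C ω ≤ 1 := by
  unfold tailInd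
  split_ifs <;> norm_num

lemma tailInd_sq (C : ℝ) (ω : Ω) : M.tailInd C ω ^ 2 = M.tailInd C ω := by
  unfold tailInd
  split_ifs <;> norm_num

lemma Y_sub_truncY (C : ℝ) (ω : Ω) :
    M.Y 0 ω - M.truncY C (M.X 0 ω, M.Y 0 ω) = M.Y 0 ω * M.tailInd C ω := by
  unfold truncY tailInd
  split_ifs <;> simp

variable [MeasurableSpace Ω] {μ : Measure Ω}

variable (h : M.Standing μ)
include h

lemma Standing.measurableSet_truncSet (C : ℝ) : MeasurableSet (M.truncSet C) := by
  have := h.measurable_F _ h.f0_mem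
  have h1 : MeasurableSet {z : M.𝒳 × ℝ | |(z.1 : ℝ)| ≤ C} :=
    measurableSet_le (by fun_prop) measurable_const
  have h2 : MeasurableSet {z : M.𝒳 × ℝ | |z.2 - M.f0 z.1| ≤ C} :=
    measurableSet_le (by fun_prop) measurable_const
  exact h1.inter h2

lemma Standing.measurable_truncY (C : ℝ) : Measurable (M.truncY C) :=
  Measurable.ite (h.measurableSet_truncSet C) measurable_snd measurable_const

lemma Standing.measurable_tailInd (C : ℝ) : Measurable (M.tailInd C) :=
  Measurable.ite (((h.measurable_X 0).prodMk (h.measurable_Y 0)) (h.measurableSet_truncSet C))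
    measurable_const measurable_const

lemma Standing.memLp_tailInd [IsProbabilityMeasure μ] (C : ℝ) : MemLp (M.tailInd C) 2 μ :=
  MemLp.of_bound (h.measurable_tailInd C).aestronglyMeasurable 1 (.of_forall fun ω => by
    rw [Real.norm_eq_abs, abs_of_nonneg (tailInd_mem C ω).1]
    exact (tailInd_mem C ω).2)

lemma Standing.measureReal_not_truncSet_le [IsProbabilityMeasure μ] {α δ C : ℝ} (hC : 0 ≤ C)
    (hX : SubGaussianTail μ (fun ω => (M.X 0 ω : ℝ)) α δ) (hε : SubGaussianTail μ (M.ε 0) α δ)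
    (i : Fin n) :
    μ.real {ω | (M.X i ω, M.Y i ω) ∉ M.truncSet C} ≤ 2 * (α * Real.exp (-δ * C ^ 2)) := by
  have e : μ.real {ω | (M.X i ω, M.Y i ω) ∉ M.truncSet C}
      = μ.real {ω | (M.X 0 ω, M.Y 0 ω) ∉ M.truncSet C} := by
    have := (h.ident i).measure_mem_eq (h.measurableSet_truncSet C).compl
    exact congrArg ENNReal.toReal this
  rw [e]
  have hsub : {ω | (M.X 0 ω, M.Y 0 ω) ∉ M.truncSet C}
      ⊆ {ω | C ≤ |(M.X 0 ω : ℝ)|} ∪ {ω | C ≤ |M.ε 0 ω|} := by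
    intro ω hω
    by_contra hcon
    simp only [Set.mem_union, Set.mem_ofPred_eq, not_or, not_le] at hcon
    exact hω ⟨hcon.1.le, by rw [ε_eq]; exact hcon.2.le⟩
  have := (measureReal_mono hsub).trans (measureReal_union_le (μ := μ) _ _)
  linarith [hX.2.2 C hC, hε.2.2 C hC]

lemma Standing.integral_tailInd [IsProbabilityMeasure μ] (C : ℝ) :
    ∫ ω, M.tailInd C ω ∂μ = μ.real {ω | (M.X 0 ω, M.Y 0 ω) ∉ M.truncSet C} := by
  have hm : MeasurableSet {ω | (M.X 0 ω, M.Y 0 ω) ∉ M.truncSet C} :=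
    ((h.measurable_X 0).prodMk (h.measurable_Y 0)) (h.measurableSet_truncSet C).compl
  rw [← integral_indicator_one hm]
  refine integral_congr_ae (.of_forall fun ω => ?_)
  by_cases hz : (M.X 0 ω, M.Y 0 ω) ∈ M.truncSet C <;> simp [tailInd, Set.indicator, hz]

/-- The bias caused by truncating the response. -/
lemma Standing.abs_integral_tail_le [IsProbabilityMeasure μ] {K : ℝ}
    (hK : ∀ j x, |M.ψ j x| ≤ K) (hK0 : 0 ≤ K) {α δ C B : ℝ} (hC : 0 < C)
    (hX : SubGaussianTail μ (fun ω => (M.X 0 ω : ℝ)) α δ) (hε : SubGaussianTail μ (M.ε 0) α δ)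
    (hq : 2 * n * (α * Real.exp (-δ * C ^ 2)) ≤ 1) {βs : Fin p → ℝ} (hB : l1 βs ≤ B)
    (d : Fin p → ℝ) :
    |∫ ω, M.Y 0 ω * M.tailInd C ω * M.fn d (M.X 0 ω) ∂μ|
      ≤ l1 d * K * (3 * C / (2 * n) + B * K / n
        + M.norm2 μ (M.fn βs - M.f0) * √(1 / (n : ℝ))) := by
  have hn : (1 : ℝ) ≤ n := Nat.one_le_cast.2 (NeZero.pos n)
  set q := α * Real.exp (-δ * C ^ 2) with hqdef
  have hJ := h.memLp_tailInd C
  have hJi : Integrable (M.tailInd C) μ := hJ.integrable one_le_two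
  have hPJ : ∫ ω, M.tailInd C ω ∂μ ≤ 2 * q := by
    rw [h.integral_tailInd C]
    exact h.measureReal_not_truncSet_le hC.le hX hε 0
  have hqn : q ≤ 1 / (2 * n) := by
    rw [le_div_iff₀ (by positivity)]; linarith
  -- The tail bound at `0` forces `α ≥ 1`, so `exp (-δ C²) ≤ q ≤ 1/2`, and `1 - δ C² ≤ exp (-δ C²)`.
  -- This makes the overshoot `q / (2δC)` at most `q * C`.
  have hδC : 1 / 2 ≤ δ * C ^ 2 := by
    have hα : 1 ≤ α := by
      have := hε.2.2 0 le_rfl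
      simpa using this
    have h1 : Real.exp (-δ * C ^ 2) ≤ q := by
      rw [hqdef]
      exact le_mul_of_one_le_left (Real.exp_pos _).le hα
    have h2 := Real.add_one_le_exp (-δ * C ^ 2)
    have h3 : 1 / (2 * (n : ℝ)) ≤ 1 / 2 := by
      rw [div_le_div_iff₀ (by positivity) (by norm_num)]; linarith
    linarith
  have hq0 : 0 ≤ q := mul_nonneg hε.1.le (Real.exp_pos _).le
  have hεi : Integrable (M.ε 0) μ := h.memLp_ε.integrable one_le_two
  have hεJ : Integrable (fun ω => |M.ε 0 ω| * M.tailInd C ω) μ := by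
    have : Integrable (fun ω => M.ε 0 ω * M.tailInd C ω) μ := h.memLp_ε.integrable_mul hJ
    refine this.abs.congr (.of_forall fun ω => ?_)
    simp only
    rw [abs_mul, abs_of_nonneg (tailInd_mem C ω).1]
  have hE : ∫ ω, |M.ε 0 ω| * M.tailInd C ω ∂μ ≤ 3 * C / (2 * n) := by
    have hov := hε.integral_overshoot_le hεi hC
    have hint' : Integrable (fun ω => max (|M.ε 0 ω| - C) 0) μ :=
      ((hεi.abs.sub (integrable_const C)).sup (integrable_const 0))
    have h1 : ∫ ω, |M.ε 0 ω| * M.tailInd C ω ∂μ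
        ≤ ∫ ω, (C * M.tailInd C ω + max (|M.ε 0 ω| - C) 0) ∂μ := by
      refine integral_mono hεJ ((hJi.const_mul C).add hint') fun ω => ?_
      obtain ⟨a1, a2⟩ := tailInd_mem (M := M) C ω
      have m1 := le_max_left (|M.ε 0 ω| - C) 0
      have m2 := le_max_right (|M.ε 0 ω| - C) 0
      simp only
      nlinarith
    rw [integral_add (hJi.const_mul C) hint', integral_const_mul] at h1
    have h2 : q / (2 * δ * C) ≤ q * C := by
      have hδ := hε.2.1
      rw [div_le_iff₀ (by positivity)]
      nlinarith
    have h3 : C * ∫ ω, M.tailInd C ω ∂μ ≤ C * (2 * q) := mul_le_mul_of_nonneg_left hPJ hC.le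
    have h4 : 3 * C * q ≤ 3 * C * (1 / (2 * n)) := by gcongr
    have h5 : 3 * C * (1 / (2 * (n : ℝ))) = 3 * C / (2 * n) := by ring
    rw [← hqdef] at hov
    linarith
  have hhL : MemLp (fun ω => |(M.fn βs - M.f0) (M.X 0 ω)|) 2 μ :=
    (h.memLp_F _ (M.F.sub_mem (h.fn_mem βs) h.f0_mem)).abs
  have hhJ : Integrable (fun ω => |(M.fn βs - M.f0) (M.X 0 ω)| * M.tailInd C ω) μ :=
    hhL.integrable_mul hJ
  have hPn : ∫ ω, M.tailInd C ω ∂μ ≤ 1 / n := by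
    have : 2 * (1 / (2 * (n : ℝ))) = 1 / n := by field_simp
    linarith
  have hH : ∫ ω, |(M.fn βs - M.f0) (M.X 0 ω)| * M.tailInd C ω ∂μ
      ≤ M.norm2 μ (M.fn βs - M.f0) * √(1 / (n : ℝ)) := by
    refine (le_abs_self _).trans ((abs_integral_mul_le hhL hJ).trans ?_)
    simp only [sq_abs, tailInd_sq]
    exact mul_le_mul_of_nonneg_left (Real.sqrt_le_sqrt hPn) (norm2_nonneg _)
  have hB0 : 0 ≤ B := (l1_nonneg βs).trans hB
  have hmain : ∫ ω, |M.Y 0 ω * M.tailInd C ω * M.fn d (M.X 0 ω)| ∂μ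
      ≤ ∫ ω, l1 d * K * (1 * (|M.ε 0 ω| * M.tailInd C ω) + B * K * M.tailInd C ω
        + 1 * (|(M.fn βs - M.f0) (M.X 0 ω)| * M.tailInd C ω)) ∂μ := by
    refine integral_mono_of_nonneg (.of_forall fun _ => abs_nonneg _)
      ((((hεJ.const_mul 1).add (hJi.const_mul _)).add (hhJ.const_mul 1)).const_mul _)
      (.of_forall fun ω => ?_)
    obtain ⟨a1, a2⟩ := tailInd_mem (M := M) C ω
    simp only
    rw [abs_mul, abs_mul, abs_of_nonneg a1, mul_comm]
    refine mul_le_mul (abs_fn_le hK d _) ?_ (by positivity)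
      (mul_nonneg (l1_nonneg d) hK0)
    -- Outside the truncation set the constant for level `C` does not bound `f0`; passing through
    -- `f*`, bounded by `B * K`, leaves a difference controlled in `L₂`.
    have hY : |M.Y 0 ω| ≤ |M.ε 0 ω| + B * K + |(M.fn βs - M.f0) (M.X 0 ω)| := by
      have e : M.Y 0 ω = M.ε 0 ω + M.fn βs (M.X 0 ω) - (M.fn βs - M.f0) (M.X 0 ω) := by
        simp [Y]; ring
      rw [e]
      refine (abs_sub _ _).trans (add_le_add_left ((abs_add_le _ _).trans
        (add_le_add_right ((abs_fn_le hK βs _).trans ?_) _)) _)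
      gcongr
    calc _ ≤ (|M.ε 0 ω| + B * K + |(M.fn βs - M.f0) (M.X 0 ω)|) * M.tailInd C ω := by gcongr
      _ = _ := by ring
  refine abs_integral_le_integral_abs.trans (hmain.trans ?_)
  rw [integral_const_mul, integral_lincomb hεJ hJi hhJ]
  have h6 : B * K * ∫ ω, M.tailInd C ω ∂μ ≤ B * K * (1 / n) := by gcongr
  have h7 : B * K * (1 / (n : ℝ)) = B * K / n := by ring
  exact mul_le_mul_of_nonneg_left (by linarith) (mul_nonneg (l1_nonneg d) hK0)

end truncation

/-! ### Control of the empirical process on the parameter set -/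

section control

variable {Ω : Type*} [MeasurableSpace Ω] {μ : Measure Ω} [IsProbabilityMeasure μ] {n p : ℕ}
  [NeZero n] {M : Model Ω n p}

omit [IsProbabilityMeasure μ] in
lemma Standing.dev_fn_mul_fn_le (h : M.Standing μ) {r : ℝ} {ω : Ω}
    (hr : ∀ k : Fin p × Fin p, |M.dev μ (fun z => M.ψ k.1 z.1 * M.ψ k.2 z.1) ω| ≤ r)
    (b c : Fin p → ℝ) :
    |M.dev μ (fun z => M.fn b z.1 * M.fn c z.1) ω| ≤ l1 b * l1 c * r := by
  have e : (fun z : M.𝒳 × ℝ => M.fn b z.1 * M.fn c z.1)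
      = fun z => ∑ k : Fin p × Fin p, b k.1 * c k.2 * (M.ψ k.1 z.1 * M.ψ k.2 z.1) := by
    funext z
    rw [fn, fn, Finset.sum_mul_sum, Fintype.sum_prod_type]
    exact Finset.sum_congr rfl fun j _ => Finset.sum_congr rfl fun k _ => by ring
  rw [e, ← l1_mul_l1]
  exact abs_dev_sum_le (g := fun (k : Fin p × Fin p) (z : M.𝒳 × ℝ) => M.ψ k.1 z.1 * M.ψ k.2 z.1)
    (fun k => (h.memLp_F _ (h.ψ_mem k.1)).integrable_mul (h.memLp_F _ (h.ψ_mem k.2)))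
    (fun k : Fin p × Fin p => b k.1 * c k.2) hr

omit [IsProbabilityMeasure μ] in
lemma Standing.memLp_truncY (h : M.Standing μ) (C : ℝ) :
    MemLp (fun ω => M.truncY C (M.X 0 ω, M.Y 0 ω)) 2 μ := by
  refine h.memLp_Y.mono ((h.measurable_truncY C).comp
    ((h.measurable_X 0).prodMk (h.measurable_Y 0))).aestronglyMeasurable (.of_forall fun ω => ?_)
  unfold truncY
  split_ifs <;> simp

omit [IsProbabilityMeasure μ] in
lemma Standing.dev_truncY_mul_fn_le (h : M.Standing μ) {C r : ℝ} {ω : Ω}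
    (hr : ∀ j, |M.dev μ (fun z => M.truncY C z * M.ψ j z.1) ω| ≤ r) (b : Fin p → ℝ) :
    |M.dev μ (fun z => M.truncY C z * M.fn b z.1) ω| ≤ l1 b * r := by
  have e : (fun z : M.𝒳 × ℝ => M.truncY C z * M.fn b z.1)
      = fun z => ∑ j, b j * (M.truncY C z * M.ψ j z.1) := by
    funext z
    rw [fn, Finset.mul_sum]
    exact Finset.sum_congr rfl fun j _ => by ring
  rw [e]
  exact abs_dev_sum_le (g := fun j (z : M.𝒳 × ℝ) => M.truncY C z * M.ψ j z.1)
    (fun j => (h.memLp_truncY C).integrable_mul (h.memLp_F _ (h.ψ_mem j))) b hr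

omit [IsProbabilityMeasure μ] in
-- On this event truncation changes no observation, so only the expectations differ.
lemma Standing.dev_Y_mul_fn_eq (h : M.Standing μ) {C : ℝ} {ω : Ω}
    (hω : ∀ i, (M.X i ω, M.Y i ω) ∈ M.truncSet C) (b : Fin p → ℝ) :
    M.dev μ (fun z => z.2 * M.fn b z.1) ω = M.dev μ (fun z => M.truncY C z * M.fn b z.1) ω
      - ∫ ω, M.Y 0 ω * M.tailInd C ω * M.fn b (M.X 0 ω) ∂μ := by
  have hf := h.memLp_F _ (h.fn_mem b)
  have h1 : Integrable (fun ω => M.Y 0 ω * M.fn b (M.X 0 ω)) μ := h.memLp_Y.integrable_mul hf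
  have h2 : Integrable (fun ω => M.truncY C (M.X 0 ω, M.Y 0 ω) * M.fn b (M.X 0 ω)) μ :=
    (h.memLp_truncY C).integrable_mul hf
  simp only [← Y_sub_truncY, sub_mul]
  rw [integral_sub h1 h2]
  unfold dev
  have e : ∀ i, M.truncY C (M.X i ω, M.Y i ω) = M.Y i ω := fun i => by
    unfold truncY
    rw [if_pos (hω i)]
  simp only [e]
  ring

/-- On the event that the truncated process is controlled, the empirical process is controlled on
the whole parameter set. -/
lemma Standing.abs_V_sub_le (h : M.Standing μ) {K : ℝ} (hK : ∀ j x, |M.ψ j x| ≤ K) (hK0 : 0 ≤ K)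
    {α δ C B F t : ℝ} (hC : 0 < C) (hF0 : 0 ≤ F)
    (hX : SubGaussianTail μ (fun ω => (M.X 0 ω : ℝ)) α δ) (hε : SubGaussianTail μ (M.ε 0) α δ)
    (hq : 2 * n * (α * Real.exp (-δ * C ^ 2)) ≤ 1) (ht : √(1 / (n : ℝ)) ≤ 2 * t)
    {βs β : Fin p → ℝ} (hBs : l1 βs ≤ B) (hB : l1 β ≤ B) {ω : Ω}
    (hω : ∀ i, (M.X i ω, M.Y i ω) ∈ M.truncSet C)
    (h1 : ∀ j, |M.dev μ (fun z => M.truncY C z * M.ψ j z.1) ω| ≤ (C + F) * K * (4 * t))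
    (h2 : ∀ k : Fin p × Fin p,
      |M.dev μ (fun z => M.ψ k.1 z.1 * M.ψ k.2 z.1) ω| ≤ K * K * (4 * t)) :
    |M.V μ β ω - M.V μ βs ω| ≤ l1 (β - βs) * (14 * K * (C + F + B * K) * t)
      + 8 * B * K * M.norm2 μ (M.fn βs - M.f0) * t := by
  have hn : (1 : ℝ) ≤ n := Nat.one_le_cast.2 (NeZero.pos n)
  have hB0 : 0 ≤ B := (l1_nonneg β).trans hB
  have hd0 := l1_nonneg (β - βs)
  have hd : l1 (β - βs) ≤ 2 * B := by linarith [l1_sub_le β βs]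
  have hs : l1 (β + βs) ≤ 2 * B := by linarith [l1_add_le β βs]
  have hv0 := norm2_nonneg (μ := μ) (M.fn βs - M.f0)
  have ht0 : 0 ≤ t := by linarith [Real.sqrt_nonneg (1 / (n : ℝ))]
  have hn1 : 1 / (n : ℝ) ≤ 2 * t := by
    refine le_trans ?_ ht
    refine Real.le_sqrt_of_sq_le ?_
    have h0 : 0 ≤ 1 / (n : ℝ) := by positivity
    have h1 : 1 / (n : ℝ) ≤ 1 := (div_le_one (by positivity)).2 hn
    nlinarith
  have d1 := h.dev_truncY_mul_fn_le h1 (β - βs)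
  have d2 := h.dev_fn_mul_fn_le h2 (β - βs) (β + βs)
  have d3 := h.abs_integral_tail_le hK hK0 hC hX hε hq hBs (β - βs)
  rw [h.V_sub_eq, h.dev_Y_mul_fn_eq hω]
  set v := M.norm2 μ (M.fn βs - M.f0)
  set D := l1 (β - βs)
  have d4 : D * l1 (β + βs) * (K * K * (4 * t)) ≤ D * (2 * B) * (K * K * (4 * t)) := by gcongr
  -- In the term with `v` the distance `D` is replaced by `2 * B`: that term is to be compared with
  -- `Δ*` itself and not with the radius.
  have d5 : D * K * (3 * C / (2 * n) + B * K / n + v * √(1 / (n : ℝ)))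
      ≤ D * K * (3 * C / 2 * (2 * t) + B * K * (2 * t)) + 2 * B * K * (v * (2 * t)) := by
    have e : D * K * (3 * C / (2 * n) + B * K / n + v * √(1 / (n : ℝ)))
        = D * K * (3 * C / 2 * (1 / n) + B * K * (1 / n)) + D * K * (v * √(1 / (n : ℝ))) := by
      field_simp
    rw [e]
    gcongr
  set A := M.dev μ (fun z => M.truncY C z * M.fn (β - βs) z.1) ω
  set I := ∫ ω, M.Y 0 ω * M.tailInd C ω * M.fn (β - βs) (M.X 0 ω) ∂μ
  set Q := M.dev μ (fun z => M.fn (β - βs) z.1 * M.fn (β + βs) z.1) ω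
  have hfin : |-2 * (A - I) + Q| ≤ 2 * |A| + 2 * |I| + |Q| := by
    refine abs_le.2 ⟨?_, ?_⟩ <;>
      linarith [le_abs_self A, neg_abs_le A, le_abs_self I, neg_abs_le I, le_abs_self Q,
        neg_abs_le Q]
  -- The coefficients of `D * K * t` add up to `14 * C + 8 * F + 12 * B * K`; this is the gap to `14
  -- * (C + F + B * K)`.
  have hslack : 0 ≤ D * K * t * (6 * F + 2 * (B * K)) := by positivity
  nlinarith

lemma Standing.measureReal_control_le (h : M.Standing μ) {K : ℝ} (hK : ∀ j x, |M.ψ j x| ≤ K)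
    (hK0 : 0 < K) {C F : ℝ} (hC : 0 < C) (hF0 : 0 ≤ F)
    (hF : ∀ x : M.𝒳, |(x : ℝ)| ≤ C → |M.f0 x| ≤ F) (hp : 2 ≤ p) :
    μ.real {ω | ∃ j, (C + F) * K * (4 * √(Real.log p / n))
        ≤ |M.dev μ (fun z => M.truncY C z * M.ψ j z.1) ω|}
      + μ.real {ω | ∃ k : Fin p × Fin p, K * K * (4 * √(Real.log p / n))
        ≤ |M.dev μ (fun z => M.ψ k.1 z.1 * M.ψ k.2 z.1) ω|} ≤ 1 / p := by
  have hψm : ∀ j, Measurable (M.ψ j) := fun j => h.measurable_F _ (h.ψ_mem j)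
  have e1 := h.measureReal_exists_dev_le (ι := Fin p)
    (g := fun j (z : M.𝒳 × ℝ) => M.truncY C z * M.ψ j z.1) (R := (C + F) * K)
    (fun j => (h.measurable_truncY C).mul ((hψm j).comp measurable_fst)) (by positivity)
    (fun j z => by
      rw [abs_mul]
      exact mul_le_mul (abs_truncY_le hC.le hF0 hF z) (hK _ _) (abs_nonneg _) (by positivity))
    (by omega)
  have e2 := h.measureReal_exists_dev_le (ι := Fin p × Fin p)
    (g := fun k (z : M.𝒳 × ℝ) => M.ψ k.1 z.1 * M.ψ k.2 z.1) (R := K * K)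
    (fun k => ((hψm _).comp measurable_fst).mul ((hψm _).comp measurable_fst)) (by positivity)
    (fun k z => by
      rw [abs_mul]
      exact mul_le_mul (hK _ _) (hK _ _) (abs_nonneg _) (by positivity))
    (by omega)
  refine (add_le_add e1 e2).trans ?_
  have hp2 : (2 : ℝ) ≤ p := by exact_mod_cast hp
  simp only [Fintype.card_prod, Fintype.card_fin, Nat.cast_mul]
  rw [← add_mul, ← mul_div_assoc, div_le_div_iff₀ (by positivity) (by positivity), one_mul]
  have h4 : 2 ^ 4 * (p : ℝ) ^ 4 ≤ (p : ℝ) ^ 4 * (p : ℝ) ^ 4 := by gcongr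
  have h3 : 2 * (p : ℝ) ^ 3 ≤ p * (p : ℝ) ^ 3 := by gcongr
  have h2 : 2 * (p : ℝ) ^ 2 ≤ p * (p : ℝ) ^ 2 := by gcongr
  have h0 : 0 ≤ (p : ℝ) ^ 4 := by positivity
  nlinarith

lemma half_le_log {p : ℕ} (hp : 2 ≤ p) : 1 / 2 ≤ Real.log p := by
  have h2 : Real.log 2 ≤ Real.log p := Real.log_le_log (by norm_num) (by exact_mod_cast hp)
  linarith [Real.log_two_gt_d9]

/-- The probability that the oracle inequality holds. -/
lemma Standing.measureReal_oracleInequality_ge (h : M.Standing μ) {K : ℝ}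
    (hK : ∀ j x, |M.ψ j x| ≤ K) (hK0 : 0 < K) {L lam0 lam1 lam2 B α δ C F : ℝ}
    {βs : Fin p → ℝ} {βhat : Ω → Fin p → ℝ} (h0 : 0 < lam0) (h8 : 8 * lam0 ≤ lam1)
    (hL : lam1 ≤ L * lam0) (hβ : βs ≠ 0)
    (hl2 : lam2 = lam1 * √((supp βs).card : ℝ) / (2 * l2 βs))
    (hφ : 0 < M.phi μ lam1 lam2 βs) (hβs : βs ∈ M.Φ)
    (hhat : ∀ ω, M.IsElasticNet lam1 lam2 ω (βhat ω))
    (hF0 : 0 ≤ F) (hF : ∀ x : M.𝒳, |(x : ℝ)| ≤ C → |M.f0 x| ≤ F)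
    (hΦ : M.Φ = {β | l1 β ≤ B})
    (hX : SubGaussianTail μ (fun ω => (M.X 0 ω : ℝ)) α δ) (hε : SubGaussianTail μ (M.ε 0) α δ)
    (hC : 0 < C)
    (hlam0 : lam0 = 14 * K * (2 * (C + 2 * F + B * K)) * √(Real.log p / n)) :
    1 - 1 / (p : ℝ) - 2 * α * n * Real.exp (-δ * C ^ 2)
      ≤ μ.real {ω | M.OracleInequality μ L lam0 lam1 lam2 βs (βhat ω)} := by
  have hn : (0 : ℝ) < n := Nat.cast_pos.2 (NeZero.pos n)
  -- Otherwise the asserted lower bound is negative.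
  by_cases hq : 2 * n * (α * Real.exp (-δ * C ^ 2)) ≤ 1
  swap
  · refine le_trans ?_ measureReal_nonneg
    have : (0 : ℝ) ≤ 1 / p := by positivity
    linarith
  -- For `p ≤ 1` the logarithm vanishes (also at `p = 0`, by convention), contradicting `lam0 > 0`.
  have hp : 2 ≤ p := by
    by_contra hp
    have hlog : Real.log (p : ℝ) = 0 := by
      have : p = 0 ∨ p = 1 := by omega
      rcases this with rfl | rfl <;> simp
    rw [hlog, zero_div, Real.sqrt_zero, mul_zero] at hlam0
    exact h0.ne' hlam0
  set t := √(Real.log p / n) with ht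
  have ht0 : 0 ≤ t := Real.sqrt_nonneg _
  have htn : √(1 / (n : ℝ)) ≤ 2 * t := by
    refine Real.sqrt_le_iff.2 ⟨by positivity, ?_⟩
    have := half_le_log hp
    rw [mul_pow, ht, Real.sq_sqrt (by positivity), ← mul_div_assoc]
    gcongr
    linarith
  have h1 : 0 < lam1 := by linarith
  have hl20 : 0 ≤ lam2 := by
    have := l2_nonneg βs
    rw [hl2]; positivity
  have hBs : l1 βs ≤ B := by rw [hΦ] at hβs; exact hβs
  have hB0 : 0 ≤ B := (l1_nonneg _).trans hBs
  have hD := h.delta_eq h1 hβ hl2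
  have hM : M.delta μ sqMargin lam1 lam2 βs = lam0 * M.Mstar μ sqMargin lam0 lam1 lam2 βs := by
    unfold Mstar
    field_simp
  set v := M.norm2 μ (M.fn βs - M.f0) with hv
  have hv0 : 0 ≤ v := norm2_nonneg _
  set a := 3 * lam1 * √((supp βs).card : ℝ) / M.phi μ lam1 lam2 βs with ha
  have ha0 : 3 * lam1 ≤ a * K := by
    have hs : 1 ≤ √((supp βs).card : ℝ) :=
      Real.one_le_sqrt.2 (Nat.one_le_cast.2 (supp_nonempty hβ).card_pos)
    have hφK := h.phi_le hK h1 hl20 hβ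
    rw [ha, div_mul_eq_mul_div, le_div_iff₀ hφ]
    have h3 : 3 * lam1 * 1 ≤ 3 * lam1 * √((supp βs).card : ℝ) := by gcongr
    rw [mul_one] at h3
    exact mul_le_mul h3 hφK hφ.le (by positivity)
  -- Here `a * K ≥ 3 * lam1 ≥ 24 * lam0` and `lam0 ≥ 28 * K * (B * K * t)`, whence the 672; the
  -- product `v * a` is then dominated by the squares in `Δ*`.
  have hbias : 8 * B * K * v * t ≤ M.delta μ sqMargin lam1 lam2 βs / 2 := by
    have e1 : 28 * K * (B * K * t) ≤ lam0 := by
      rw [hlam0]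
      have : 0 ≤ K * t * (C + 2 * F) := by positivity
      nlinarith
    have e2 : K * (672 * (B * K * t)) ≤ K * a := by linarith
    have e3 : 672 * (B * K * t) ≤ a := le_of_mul_le_mul_left e2 hK0
    have e4 : v * (672 * (B * K * t)) ≤ v * a := mul_le_mul_of_nonneg_left e3 hv0
    rw [hD]
    nlinarith [sq_nonneg (v - a), sq_nonneg v]
  have hlin : 14 * K * (C + F + B * K) * t ≤ lam0 / 2 := by
    rw [hlam0]
    have : 0 ≤ K * t * F := by positivity
    nlinarith
  -- Covering the whole space and using subadditivity avoids complements: `βhat` is an arbitrary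
  -- selection, so the good event need not be measurable.
  have hcover : (Set.univ : Set Ω) ⊆ {ω | M.OracleInequality μ L lam0 lam1 lam2 βs (βhat ω)}
      ∪ (({ω | ∃ j, (C + F) * K * (4 * t)
            ≤ |M.dev μ (fun z => M.truncY C z * M.ψ j z.1) ω|}
          ∪ {ω | ∃ k : Fin p × Fin p, K * K * (4 * t)
            ≤ |M.dev μ (fun z => M.ψ k.1 z.1 * M.ψ k.2 z.1) ω|})
        ∪ ⋃ i : Fin n, {ω | (M.X i ω, M.Y i ω) ∉ M.truncSet C}) := by
    intro ω _
    by_contra hcon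
    simp only [Set.mem_union, Set.mem_iUnion, Set.mem_ofPred_eq, not_or, not_exists, not_le,
      not_not] at hcon
    obtain ⟨hno, ⟨hc1, hc2⟩, hc3⟩ := hcon
    refine hno (h.oracleInequality_of_deviation h0 h8 hL hβ hl2 hφ hβs (hhat ω) ?_)
    intro β hβΦ hR
    have hBβ : l1 β ≤ B := by rw [hΦ] at hβΦ; exact hβΦ
    refine (h.abs_V_sub_le hK hK0.le hC hF0 hX hε hq htn hBs hBβ hc3 (fun j => (hc1 j).le)
      (fun k => (hc2 k).le)).trans ?_
    have e1 : l1 (β - βs) * (14 * K * (C + F + B * K) * t)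
        ≤ M.Mstar μ sqMargin lam0 lam1 lam2 βs * (lam0 / 2) :=
      mul_le_mul hR hlin (by positivity) ((l1_nonneg _).trans hR)
    linarith
  have hU := measureReal_mono (μ := μ) hcover
  rw [probReal_univ] at hU
  have hA : μ.real (⋃ i : Fin n, {ω | (M.X i ω, M.Y i ω) ∉ M.truncSet C})
      ≤ n * (2 * (α * Real.exp (-δ * C ^ 2))) := by
    refine (measureReal_iUnion_fintype_le _).trans ?_
    refine (Finset.sum_le_sum fun i _ =>
      h.measureReal_not_truncSet_le hC.le hX hε i).trans (le_of_eq ?_)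
    rw [Finset.sum_const, Finset.card_univ, Fintype.card_fin, nsmul_eq_mul]
  have hcontrol := h.measureReal_control_le hK hK0 hC hF0 hF hp
  have hU2 := hU.trans ((measureReal_union_le _ _).trans (add_le_add_right
    ((measureReal_union_le _ _).trans (add_le_add_left (measureReal_union_le _ _) _)) _))
  linarith

end control

end Model

end ElasticNet

/-! ### The main theorem. -/

open ElasticNet in
theorem lemma1 (K : ℝ) (hK : 0 < K) :
    ∃ d : ℝ, 0 < d ∧
      ∀ (Ω : Type*) [MeasurableSpace Ω] (μ : MeasureTheory.Measure Ω)
        [MeasureTheory.IsProbabilityMeasure μ]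
        (n p : ℕ) [NeZero n] (M : Model Ω n p) (η L lam0 lam1 : ℝ)
        (lam2 : (Fin p → ℝ) → ℝ) (βs : Fin p → ℝ) (βhat : Ω → Fin p → ℝ),
        M.Standing μ →
        0 < η →
        (∀ j x, |M.ψ j x| ≤ K) →
        M.IsOracle μ sqMargin lam1 lam2 βs →
        βs ≠ 0 →
        lam2 βs = lam1 * √((supp βs).card : ℝ) / (2 * l2 βs) →
        (∀ ω, M.IsElasticNet lam1 (lam2 βs) ω (βhat ω)) →
        8 ≤ L →
        0 < lam0 →
        8 * lam0 ≤ lam1 →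
        lam1 ≤ L * lam0 →
        36 * L ^ 2 * lam0 * ((supp βs).card : ℝ) * K / (η * M.phi μ lam1 (lam2 βs) βs ^ 2) ≤ 1 →
        (∀ x, |M.fn βs x - M.f0 x| ≤ η / 2) →
        3 / 2 * M.mse μ (M.fn βs)
          ≤ 9 * lam1 ^ 2 * ((supp βs).card : ℝ) / M.phi μ lam1 (lam2 βs) βs ^ 2 →
        (M.cov μ).rank = p →
        -- Part (a): the three assumptions hold, and the oracle inequality holds on `τ`.
        ((M.MarginCondition μ η sqMargin
            ∧ (M.fn βs ∈ M.localSet η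
              ∧ ∀ β, l1 (β - βs) ≤ M.Mstar μ sqMargin lam0 lam1 (lam2 βs) βs →
                  M.fn β ∈ M.localSet η)
            ∧ 0 < M.phi μ lam1 (lam2 βs) βs
            ∧ ∀ ω ∈ M.tau μ sqMargin lam0 lam1 (lam2 βs) βs,
                M.OracleInequality μ L lam0 lam1 (lam2 βs) βs (βhat ω))
        -- Part (b): the oracle inequality holds with high probability.
        ∧ ∀ (F : ℝ → NNReal) (G α δ : ℝ),
            (1 / (n : ℝ)) * ∑ i, (⨆ j, ∫ ω, M.ψ j (M.X i ω) ^ 2 ∂μ) ≤ 1 →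
            (∀ C : ℝ, 0 < C → ∀ x : M.𝒳, |(x : ℝ)| ≤ C → |M.f0 x| ≤ F C) →
            M.Φ = {β | l1 β ≤ G} →
            SubGaussianTail μ (fun ω => (M.X 0 ω : ℝ)) α δ →
            SubGaussianTail μ (M.ε 0) α δ →
            ∀ C : ℝ, 0 < C →
              lam0 = d * (2 * (C + 2 * F C + G * K)) * √(Real.log p / n) →
              1 - 1 / (p : ℝ) - 2 * α * n * Real.exp (-δ * C ^ 2)
                ≤ μ.real {ω | M.OracleInequality μ L lam0 lam1 (lam2 βs) βs (βhat ω)}) := by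
  -- The 14 is the coefficient of the linear term in `Standing.abs_V_sub_le`; the factor 2 in `D_n`
  -- leaves the other half of `Δ*` for the bias.
  refine ⟨14 * K, by positivity, ?_⟩
  intro Ω _ μ _ n p _ M η L lam0 lam1 lam2 βs βhat h hη hψ horacle hβ hl2 hhat _ h0 h8 hL hsmall
    happrox hmse hcov
  have h1 : 0 < lam1 := by linarith
  have hl20 : 0 ≤ lam2 βs := by
    have := l2_nonneg βs
    rw [hl2]; positivity
  have hφ := h.phi_pos hcov h1 hl20 hβ
  refine ⟨⟨h.marginCondition η, ⟨⟨h.fn_mem βs, fun x => (happrox x).trans (by linarith)⟩,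
    fun β hR => h.fn_mem_localSet hψ hK hη h0 h1 hL hβ hl2 hφ hsmall happrox hmse hR⟩, hφ,
    fun ω hω => ?_⟩, ?_⟩
  · refine h.oracleInequality_of_deviation h0 h8 hL hβ hl2 hφ horacle.1 (hhat ω) ?_
    intro β _ hR
    refine (h.abs_V_sub_le_Z hψ hR ω).trans (le_trans hω (le_of_eq ?_))
    unfold Model.Mstar
    field_simp
  · intro F B α δ _ hF hΦ hX hε C hC hlam0
    exact h.measureReal_oracleInequality_ge hψ hK h0 h8 hL hβ hl2 hφ horacle.1 hhat (F C).2
      (hF C hC) hΦ hX hε hC hlam0
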